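/- Let $q$ be a power of an odd prime and let $E$ be an elliptic curve defined over $\mathbb{F}_q$. The number of homogeneous quartic polynomials $f_4(x,y)\in\mathbb{F}_q[x,y]$ such that the curve $w^2=f_4(x,y)$ in the weighted projective plane $\mathbb{P}(1,1,2)$ (with $x,y$ of weight $1$ and $w$ of weight $2$) is isomorphic to $E$ over $\mathbb{F}_q$, as a curve without marked point, is $$(q-1)\,\frac{|\mathrm{PGL}_2(\mathbb{F}_q)|}{|\mathrm{Aut}_{\mathbb{F}_q}(E)|}=\frac{(q-1)^2\,q\,(q+1)}{|\mathrm{Aut}_{\mathbb{F}_q}(E)|},$$ where $\mathrm{Aut}_{\mathbb{F}_q}(E)$ is the (finite) group of automorphisms of the curve $E$ that are defined over $\mathbb{F}_q$ and fix the identity element of $E$. -/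

import Mathlib

open MvPolynomial

/-- A curve over a field `k` given by one weighted homogeneous equation in the weighted projective
plane `ℙ(d₀, d₁, d₂)` with positive weights `dᵢ`. Ordinary plane curves have all weights `1`. -/
structure WeightedPlaneCurve (k : Type*) [Field k] where
  /-- the weights of the three coordinates -/
  weight : Fin 3 → ℕ
  weight_pos : ∀ i, 0 < weight i
  /-- the defining equation -/
  poly : MvPolynomial (Fin 3) k
  /-- the weighted degree of the equation -/
  degree : ℕ
  isWeightedHomogeneous : poly.IsWeightedHomogeneous weight degree

namespace WeightedPlaneCurve

variable {k : Type*} [Field k]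

/-- Coordinate vectors, with entries in an extension `K` of `k`, of points of the curve: the nonzero
vectors satisfying the equation. -/
abbrev Cone (C : WeightedPlaneCurve k) (K : Type*) [Field K] [Algebra k K] : Type _ :=
  {v : Fin 3 → K // v ≠ 0 ∧ aeval v C.poly = 0}

/-- Two coordinate vectors are equivalent if they differ by the weighted scaling
`(v₀, v₁, v₂) ↦ (t ^ d₀ * v₀, t ^ d₁ * v₁, t ^ d₂ * v₂)` with `t ≠ 0`. -/
instance coneSetoid (C : WeightedPlaneCurve k) (K : Type*) [Field K] [Algebra k K] :
    Setoid (C.Cone K) where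
  r u v := ∃ t : Kˣ, ∀ i, v.1 i = (t : K) ^ C.weight i * u.1 i
  iseqv :=
    { refl := fun u => ⟨1, fun i => by simp⟩
      symm := by
        rintro u v ⟨t, h⟩
        refine ⟨t⁻¹, fun i => ?_⟩
        rw [h i, ← mul_assoc, ← mul_pow]
        simp
      trans := by
        rintro u v w ⟨t, h⟩ ⟨s, h'⟩
        refine ⟨s * t, fun i => ?_⟩
        rw [h' i, h i, Units.val_mul, mul_pow, mul_assoc] }

/-- The geometric points of the curve, i.e. its points over an algebraic closure of `k`. -/
def Point (C : WeightedPlaneCurve k) : Type _ :=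
  Quotient (C.coneSetoid (AlgebraicClosure k))

/-- The geometric point with given coordinate vector. -/
noncomputable def Point.mk {C : WeightedPlaneCurve k} (v : C.Cone (AlgebraicClosure k)) : C.Point :=
  Quotient.mk _ v

/-- A map on geometric points is a morphism of varieties defined over `k` if around every geometric
point `P` it is given by polynomials over `k`: there are `F₀, F₁, F₂ ∈ k[x₀, x₁, x₂]`, weighted
homogeneous of degrees `n * e₀, n * e₁, n * e₂`, where the `eᵢ` are the weights of the target, which
do not all vanish at `P`, and the map sends `Q` to `[F₀(Q) : F₁(Q) : F₂(Q)]` wherever the `Fᵢ`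
do not all vanish. -/
def IsMorphism {C D : WeightedPlaneCurve k} (φ : C.Point → D.Point) : Prop :=
  ∀ P : C.Cone (AlgebraicClosure k), ∃ (n : ℕ) (F : Fin 3 → MvPolynomial (Fin 3) k),
    (∀ i, (F i).IsWeightedHomogeneous C.weight (n * D.weight i)) ∧
    (∃ i, aeval P.1 (F i) ≠ 0) ∧
    ∀ Q : C.Cone (AlgebraicClosure k), (∃ i, aeval Q.1 (F i) ≠ 0) →
      ∃ R : D.Cone (AlgebraicClosure k),
        (∀ i, R.1 i = aeval Q.1 (F i)) ∧ φ (Point.mk Q) = Point.mk R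

/-- A bijection on geometric points is an isomorphism over `k` if it and its inverse are morphisms
over `k`. -/
def IsIso {C D : WeightedPlaneCurve k} (φ : C.Point ≃ D.Point) : Prop :=
  IsMorphism (φ : C.Point → D.Point) ∧ IsMorphism (φ.symm : D.Point → C.Point)

/-- Two curves are isomorphic over `k`. -/
def Isomorphic (C D : WeightedPlaneCurve k) : Prop :=
  ∃ φ : C.Point ≃ D.Point, IsIso φ

end WeightedPlaneCurve

/-- The curve `w² = f(x, y)` attached to a binary quartic form `f`, in the weighted projective plane
`ℙ(1, 1, 2)` with coordinates `x, y, w`. -/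
noncomputable def quarticCurve {k : Type*} [Field k] (f : homogeneousSubmodule (Fin 2) k 4) :
    WeightedPlaneCurve k where
  weight := ![1, 1, 2]
  weight_pos i := by fin_cases i <;> simp
  poly := X 2 ^ 2 - aeval ![X 0, X 1] f.1
  degree := 4
  isWeightedHomogeneous := by
    have h2 : (X 2 ^ 2 : MvPolynomial (Fin 3) k).IsWeightedHomogeneous ![1, 1, 2] 4 := by
      have h := (isWeightedHomogeneous_X k ![1, 1, 2] (2 : Fin 3)).pow 2
      exact h
    have hf : (aeval ![X 0, X 1] f.1 : MvPolynomial (Fin 3) k).IsWeightedHomogeneous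
        ![1, 1, 2] 4 := by
      rw [aeval_def, eval₂_eq]
      refine (weightedHomogeneousSubmodule k ![1, 1, 2] 4).sum_mem fun d hd => ?_
      rw [mem_weightedHomogeneousSubmodule]
      have hd4 : d 0 + d 1 = 4 := by
        have := f.2 (mem_support_iff.mp hd)
        simpa [Finsupp.weight_apply, Finsupp.sum_fintype] using this
      have h0 := (isWeightedHomogeneous_X k ![1, 1, 2] (0 : Fin 3)).pow (d 0)
      have h1 := (isWeightedHomogeneous_X k ![1, 1, 2] (1 : Fin 3)).pow (d 1)
      have hc := isWeightedHomogeneous_C ![1, 1, 2] (coeff d f.1)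
      have hprod : ∏ i ∈ d.support, (![X 0, X 1] i : MvPolynomial (Fin 3) k) ^ d i
          = X 0 ^ d 0 * X 1 ^ d 1 := by
        rw [Finset.prod_subset (Finset.subset_univ _)
          (fun i _ hi => by rw [Finsupp.notMem_support_iff.mp hi, pow_zero])]
        simp
      rw [hprod]
      simpa [hd4] using hc.mul (h0.mul h1)
    exact (weightedHomogeneousSubmodule k ![1, 1, 2] 4).sub_mem h2 hf

/-- An elliptic curve in Weierstrass form, as a plane cubic in `ℙ²`. -/
noncomputable def weierstrassCurve {k : Type*} [Field k] (E : WeierstrassCurve k) :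
    WeightedPlaneCurve k where
  weight := 1
  weight_pos _ := Nat.one_pos
  poly := WeierstrassCurve.Projective.polynomial E
  degree := 3
  isWeightedHomogeneous := by
    have hX (i : Fin 3) : (X i : MvPolynomial (Fin 3) k).IsHomogeneous 1 := isHomogeneous_X k i
    have hC (a : k) : (C a : MvPolynomial (Fin 3) k).IsHomogeneous 0 := isHomogeneous_C _ a
    rw [WeierstrassCurve.Projective.polynomial]
    refine IsHomogeneous.sub (IsHomogeneous.add (IsHomogeneous.add ?_ ?_) ?_)
      (IsHomogeneous.add (IsHomogeneous.add (IsHomogeneous.add ?_ ?_) ?_) ?_)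
    · exact ((hX 1).pow 2).mul (hX 2)
    · exact (((hC _).mul (hX 0)).mul (hX 1)).mul (hX 2)
    · exact ((hC _).mul (hX 1)).mul ((hX 2).pow 2)
    · exact (hX 0).pow 3
    · exact ((hC _).mul ((hX 0).pow 2)).mul (hX 2)
    · exact ((hC _).mul (hX 0)).mul ((hX 2).pow 2)
    · exact (hC _).mul ((hX 2).pow 3)

/-- The identity element `O = [0 : 1 : 0]` of a Weierstrass curve. -/
noncomputable def weierstrassOrigin {k : Type*} [Field k] (E : WeierstrassCurve k) :
    (weierstrassCurve E).Point :=
  WeightedPlaneCurve.Point.mk ⟨![0, 1, 0], fun h => one_ne_zero (congrFun h 1), by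
    simp [weierstrassCurve, WeierstrassCurve.Projective.polynomial]⟩

/-- `Aut_k(E)`: the automorphisms of the curve `E` defined over `k` that fix the identity element. -/
def EllipticAut {k : Type*} [Field k] (E : WeierstrassCurve k) : Type _ :=
  {φ : (weierstrassCurve E).Point ≃ (weierstrassCurve E).Point //
    WeightedPlaneCurve.IsIso φ ∧ φ (weierstrassOrigin E) = weierstrassOrigin E}

/-- The projective general linear group `PGL₂(k)`: the quotient of `GL₂(k)` by its centre. -/
abbrev PGL2 (k : Type*) [Field k] : Type _ :=
  GL (Fin 2) k ⧸ Subgroup.center (GL (Fin 2) k)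

/-- The binary quartic forms `f` over `k` for which `w² = f(x, y)` is isomorphic to `E` over `k`. -/
def quarticsIsomorphicTo {k : Type*} [Field k] (E : WeierstrassCurve k) :
    Set (homogeneousSubmodule (Fin 2) k 4) :=
  {f | WeightedPlaneCurve.Isomorphic (quarticCurve f) (weierstrassCurve E)}

/-!
The forms `f` are counted together with their parametrizations, that is the isomorphisms of curves
`φ` from `C_f : w² = f(x, y)` to `E`. A form which occurs at all occurs with as many parametrizations
as the curve `E` has automorphisms over `k`. To a parametrization belongs the rational point
`mirror φ = φ(ι(φ⁻¹(O)))` of `E`, where `ι : w ↦ -w` is the involution of `C_f`, and everything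
follows from a description of the parametrizations with a given rational point `P`.

* Each rational point `P` occurs: there are a form `h` and an isomorphism `C_h ≃ E` which maps the
  points on the line `y = 0` to `O` and `P` (`exists_isPresentation`). If `P = O`, complete the square
  in the Weierstrass equation. Otherwise translate `-P` to `(0, 0)` and project from that point: the
  projection is the quotient by `X ↦ P - X`, which interchanges `O` and `P`, because a line through
  `-P` meets `E` in two further points whose sum is `P`. The isomorphisms
  are given by explicit polynomial charts, and their composites are checked by polynomial identities.
* Two parametrizations with the same point differ by a linear isomorphism
  `(x, y, w) ↦ (g(x, y), e w)` with `g ∈ GL₂(k)` and `e ∈ kˣ` (`IsPresentation.exists_isLinear`).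
  After a linear change of coordinates the isomorphism respects the lines `y = 0`, hence gives an
  isomorphism of affine coordinate rings `k[x, w] / (w² - h(x, 1))`
  (`exists_evalHom_eq`, by the Nullstellensatz). The norm of `x - c` has degree `2` for every constant
  `c`. Only linear polynomials in `x` have this property (`im_eq_zero_of_natDegree_norm`), and this
  determines the image of `x` and then that of `w` (`exists_linear_of_algEquiv`).
* The pairs `(g, e)` and `(t g, t² e)` induce the same map, and there are no other coincidences
  (`IsLinear.exists_smul_eq`). So there are `|GL₂(k)|` parametrizations for each rational point.

Hence the number of forms times the number of automorphisms of the curve `E` is `|E(k)| |GL₂(k)|`. The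
transports of the involutions `ι` show that the automorphisms of the curve act transitively on `E(k)`
(`exists_isIso_apply_origin`), so their number is `|E(k)|` times the order of the stabilizer
`Aut_k(E)` of `O`. This gives `|GL₂(k)| = (q - 1) |PGL₂(k)|` for the product of the number of forms and
`|Aut_k(E)|` (`card_quartics_mul_card_aut`).
-/

/-! ### Weighted plane curves, their isomorphisms and their rational points -/

theorem MvPolynomial.IsWeightedHomogeneous.aeval_pow_mul {k K σ : Type*} [CommSemiring k]
    [CommSemiring K] [Algebra k K] {w : σ → ℕ} {F : MvPolynomial σ k} {n : ℕ}
    (hF : F.IsWeightedHomogeneous w n) (t : K) (v : σ → K) :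
    aeval (fun i => t ^ w i * v i) F = t ^ n * aeval v F := by
  rw [aeval_def, aeval_def, eval₂_eq, eval₂_eq, Finset.mul_sum]
  refine Finset.sum_congr rfl fun d hd => ?_
  have hd' : ∑ i ∈ d.support, d i * w i = n := by
    simpa [Finsupp.weight_apply, Finsupp.sum] using hF (mem_support_iff.mp hd)
  have : ∏ i ∈ d.support, (t ^ w i * v i) ^ d i = t ^ n * ∏ i ∈ d.support, v i ^ d i := by
    rw [← hd', ← Finset.prod_pow_eq_pow_sum, ← Finset.prod_mul_distrib]
    exact Finset.prod_congr rfl fun i _ => by rw [mul_pow, ← pow_mul, mul_comm (w i)]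
  rw [this]; ring

theorem MvPolynomial.IsWeightedHomogeneous.bind₁ {k σ τ : Type*} [CommSemiring k]
    {w : σ → ℕ} {u : τ → ℕ} {G : MvPolynomial τ k} {m n : ℕ} {F : τ → MvPolynomial σ k}
    (hG : G.IsWeightedHomogeneous u m) (hF : ∀ i, (F i).IsWeightedHomogeneous w (n * u i)) :
    (MvPolynomial.bind₁ F G).IsWeightedHomogeneous w (n * m) := by
  change (aeval F G).IsWeightedHomogeneous w (n * m)
  rw [aeval_def, eval₂_eq]
  refine IsWeightedHomogeneous.sum _ _ _ fun d hd => ?_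
  have hd' : ∑ i ∈ d.support, d i * u i = m := by
    simpa [Finsupp.weight_apply, Finsupp.sum] using hG (mem_support_iff.mp hd)
  have h := IsWeightedHomogeneous.prod d.support (fun i => F i ^ d i) (fun i => d i * (n * u i))
    fun i _ => by simpa using (hF i).pow (d i)
  have hs : ∑ i ∈ d.support, d i * (n * u i) = n * m := by
    rw [← hd', Finset.mul_sum]; exact Finset.sum_congr rfl fun i _ => by ring
  rw [hs] at h
  exact h.C_mul _

namespace WeightedPlaneCurve

variable {k : Type*} [Field k] {C D B : WeightedPlaneCurve k}

theorem Point.mk_eq_mk {u v : C.Cone (AlgebraicClosure k)} :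
    Point.mk u = Point.mk v ↔
      ∃ t : AlgebraicClosure k, t ≠ 0 ∧ ∀ i, v.1 i = t ^ C.weight i * u.1 i := by
  refine ⟨fun h => ?_, fun ⟨t, ht, h⟩ => Quotient.sound ⟨Units.mk0 t ht, h⟩⟩
  obtain ⟨t, h⟩ := Quotient.exact h
  exact ⟨t, t.ne_zero, h⟩

theorem Point.exists_rep (P : C.Point) : ∃ v, Point.mk v = P := Quotient.exists_rep P

/-- A vector which is a nonzero multiple of a vector of the cone. -/
theorem exists_mk_eq {v : C.Cone (AlgebraicClosure k)} {u : Fin 3 → AlgebraicClosure k}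
    {t : AlgebraicClosure k} (ht : t ≠ 0) (h : ∀ i, u i = t ^ C.weight i * v.1 i) :
    ∃ u' : C.Cone (AlgebraicClosure k), u'.1 = u ∧ Point.mk u' = Point.mk v := by
  have hu : u = fun i => t ^ C.weight i * v.1 i := funext h
  refine ⟨⟨u, fun h0 => v.2.1 ?_, ?_⟩, rfl, (Point.mk_eq_mk.2 ⟨t, ht, h⟩).symm⟩
  · ext i
    have := h i
    rw [h0] at this
    simpa [ht] using this.symm
  · rw [hu, C.isWeightedHomogeneous.aeval_pow_mul, v.2.2, mul_zero]

/-- The degrees of the polynomials defining a morphism near a point can be taken to be positive. -/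
theorem IsMorphism.exists_pos_degree {φ : C.Point → D.Point} (hφ : IsMorphism φ)
    (P : C.Cone (AlgebraicClosure k)) : ∃ (n : ℕ) (F : Fin 3 → MvPolynomial (Fin 3) k), 0 < n ∧
    (∀ i, (F i).IsWeightedHomogeneous C.weight (n * D.weight i)) ∧
    (∃ i, aeval P.1 (F i) ≠ 0) ∧
    ∀ Q : C.Cone (AlgebraicClosure k), (∃ i, aeval Q.1 (F i) ≠ 0) →
      ∃ R : D.Cone (AlgebraicClosure k),
        (∀ i, R.1 i = aeval Q.1 (F i)) ∧ φ (Point.mk Q) = Point.mk R := by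
  obtain ⟨n, F, hF, ⟨i₀, hi₀⟩, h⟩ := hφ P
  obtain ⟨j, hj⟩ : ∃ j, P.1 j ≠ 0 := by
    by_contra! h
    exact P.2.1 (funext h)
  refine ⟨n + C.weight j, fun i => X j ^ D.weight i * F i, by have := C.weight_pos j; omega,
    fun i => ?_, ⟨i₀, by simpa using ⟨fun h => absurd h hj, hi₀⟩⟩, fun Q ⟨i, hi⟩ => ?_⟩
  · have h1 := ((isWeightedHomogeneous_X k C.weight j).pow (D.weight i)).mul (hF i)
    rwa [smul_eq_mul, show D.weight i * C.weight j + n * D.weight i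
      = (n + C.weight j) * D.weight i by ring] at h1
  · simp only [map_mul, map_pow, aeval_X] at hi ⊢
    have hD := D.weight_pos i
    have hQ : Q.1 j ≠ 0 := fun h0 => hi (by rw [h0, zero_pow hD.ne', zero_mul])
    obtain ⟨R, hR, hR'⟩ := h Q ⟨i, right_ne_zero_of_mul hi⟩
    obtain ⟨R', h1, h2⟩ := exists_mk_eq (v := R) hQ (fun i => rfl)
    exact ⟨R', fun i => by rw [h1, ← hR], hR'.trans h2.symm⟩

theorem IsMorphism.comp {ψ : D.Point → B.Point} {φ : C.Point → D.Point} (hψ : IsMorphism ψ)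
    (hφ : IsMorphism φ) : IsMorphism (ψ ∘ φ) := by
  intro P
  obtain ⟨n, F, hF, hP, h⟩ := hφ P
  obtain ⟨R, hR, hR'⟩ := h P hP
  obtain ⟨m, G, hm, hG, ⟨i, hi⟩, h'⟩ := hψ.exists_pos_degree R
  have key : ∀ (Q : Fin 3 → AlgebraicClosure k) i,
      aeval Q (bind₁ F (G i)) = aeval (fun j => aeval Q (F j)) (G i) := fun Q i => by
    rw [aeval_bind₁]
  have hR1 : R.1 = fun j => aeval P.1 (F j) := funext hR
  refine ⟨n * m, fun i => bind₁ F (G i), fun i => ?_, ⟨i, ?_⟩, fun Q ⟨i, hi⟩ => ?_⟩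
  · rw [mul_assoc]
    exact (hG i).bind₁ hF
  · rwa [key, ← hR1]
  · rw [key] at hi
    have hQ : ∃ i, aeval Q.1 (F i) ≠ 0 := by
      by_contra! h0
      -- a form of positive degree vanishes at the zero vector
      have := (hG i).aeval_pow_mul (0 : AlgebraicClosure k) (fun j => aeval Q.1 (F j))
      rw [zero_pow (Nat.mul_pos hm (B.weight_pos i)).ne', zero_mul] at this
      refine hi (Eq.trans ?_ this)
      congr 2
      ext j
      rw [h0 j, mul_zero]
    obtain ⟨S, hS, hS'⟩ := h Q hQ
    have hS1 : S.1 = fun j => aeval Q.1 (F j) := funext hS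
    obtain ⟨T, hT, hT'⟩ := h' S ⟨i, by rwa [hS1]⟩
    exact ⟨T, fun i => by rw [hT, key, hS1], by rw [Function.comp_apply, hS', hT']⟩

theorem IsIso.symm {φ : C.Point ≃ D.Point} (h : IsIso φ) : IsIso φ.symm := ⟨h.2, h.1⟩

theorem IsIso.trans {φ : C.Point ≃ D.Point} {ψ : D.Point ≃ B.Point} (hφ : IsIso φ)
    (hψ : IsIso ψ) : IsIso (φ.trans ψ) := ⟨hψ.1.comp hφ.1, hφ.2.comp hψ.2⟩

/-- A geometric point is rational if it has a coordinate vector with entries in `k`. -/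
def Point.IsRational (P : C.Point) : Prop :=
  ∃ (v : Fin 3 → k) (h : _), P = Point.mk ⟨fun i => algebraMap k (AlgebraicClosure k) (v i), h⟩

theorem aeval_algebraMap_comp {F : MvPolynomial (Fin 3) k} (v : Fin 3 → k) :
    aeval (fun i => algebraMap k (AlgebraicClosure k) (v i)) F =
      algebraMap k (AlgebraicClosure k) (eval v F) := by
  have := aeval_algebraMap_apply (AlgebraicClosure k) v F
  rw [← coe_aeval_eq_eval]
  exact this

theorem IsMorphism.isRational {φ : C.Point → D.Point} (hφ : IsMorphism φ) {P : C.Point}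
    (hP : P.IsRational) : (φ P).IsRational := by
  obtain ⟨v, hv, rfl⟩ := hP
  obtain ⟨n, F, -, h0, h⟩ := hφ ⟨_, hv⟩
  obtain ⟨R, hR, hR'⟩ := h _ h0
  have : R.1 = fun i => algebraMap k (AlgebraicClosure k) (eval v (F i)) := funext fun i => by
    rw [hR, aeval_algebraMap_comp]
  refine ⟨fun i => eval v (F i), this ▸ R.2, hR'.trans ?_⟩
  congr 1
  exact Subtype.ext this

theorem finite_isRational [Finite k] : {P : C.Point | P.IsRational}.Finite := by
  classical
  let f : (Fin 3 → k) → Set C.Point := fun v =>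
    {P | ∃ h, P = Point.mk ⟨fun i => algebraMap k (AlgebraicClosure k) (v i), h⟩}
  have hf : ∀ v, (f v).Finite := fun v => by
    refine Set.Subsingleton.finite ?_
    rintro _ ⟨h, rfl⟩ _ ⟨h', rfl⟩
    rfl
  refine (Set.finite_iUnion hf).subset ?_
  rintro P ⟨v, h, rfl⟩
  exact Set.mem_iUnion.2 ⟨v, h, rfl⟩

/-- One direction of `exists_isIso_of_charts`. -/
theorem exists_map_of_charts {ι κ : Type*}
    (n : ι → ℕ) (F : ι → Fin 3 → MvPolynomial (Fin 3) k)
    (G : κ → Fin 3 → MvPolynomial (Fin 3) k)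
    (hF : ∀ j i, (F j i).IsWeightedHomogeneous C.weight (n j * D.weight i))
    (hFD : ∀ j (Q : C.Cone (AlgebraicClosure k)), aeval (fun i => aeval Q.1 (F j i)) D.poly = 0)
    (hF0 : ∀ Q : C.Cone (AlgebraicClosure k), ∃ j i, aeval Q.1 (F j i) ≠ 0)
    (hG0 : ∀ R : D.Cone (AlgebraicClosure k), ∃ l i, aeval R.1 (G l i) ≠ 0)
    (hGF : ∀ j l (Q : C.Cone (AlgebraicClosure k)), ∃ t : AlgebraicClosure k, ∀ i,
      aeval (fun i' => aeval Q.1 (F j i')) (G l i) = t ^ C.weight i * Q.1 i)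
    (hFG : ∀ j l (R : D.Cone (AlgebraicClosure k)), ∃ t : AlgebraicClosure k, ∀ i,
      aeval (fun i' => aeval R.1 (G l i')) (F j i) = t ^ D.weight i * R.1 i) :
    ∃ φ : C.Point → D.Point, ∀ j Q, (∃ i, aeval Q.1 (F j i) ≠ 0) →
      ∃ R : D.Cone (AlgebraicClosure k),
        (∀ i, R.1 i = aeval Q.1 (F j i)) ∧ φ (Point.mk Q) = Point.mk R := by
  classical
  let val : ∀ (j : ι) (Q : C.Cone (AlgebraicClosure k)), (∃ i, aeval Q.1 (F j i) ≠ 0) →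
      D.Cone (AlgebraicClosure k) := fun j Q h =>
    ⟨fun i => aeval Q.1 (F j i), fun h0 => by
      obtain ⟨i, hi⟩ := h
      exact hi (congrFun h0 i), hFD j Q⟩
  -- two charts of `F` agree wherever both are defined, because both are inverted by the `G l`
  have hval : ∀ j j' Q h h', Point.mk (val j Q h) = Point.mk (val j' Q h') := by
    intro j j' Q h h'
    obtain ⟨l, i, hi⟩ := hG0 (val j Q h)
    obtain ⟨t, ht⟩ := hGF j l Q
    have ht0 : t ≠ 0 := fun h0 => hi ((ht i).trans (by
      rw [h0, zero_pow (C.weight_pos i).ne', zero_mul]))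
    obtain ⟨s, hs⟩ := hFG j' l (val j Q h)
    have hsQ : ∀ i, (t ^ n j') ^ D.weight i * aeval Q.1 (F j' i)
        = s ^ D.weight i * (val j Q h).1 i := fun i => by
      rw [← hs i]
      have : (fun i' => aeval (val j Q h).1 (G l i')) = fun i' => t ^ C.weight i' * Q.1 i' :=
        funext ht
      rw [this, (hF j' i).aeval_pow_mul, pow_mul]
    obtain ⟨i', hi'⟩ := h'
    have hs0 : s ≠ 0 := fun h0 => by
      have := hsQ i'
      rw [h0, zero_pow (D.weight_pos i').ne', zero_mul] at this
      exact mul_ne_zero (pow_ne_zero _ (pow_ne_zero _ ht0)) hi' this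
    refine Point.mk_eq_mk.2 ⟨s / t ^ n j', div_ne_zero hs0 (pow_ne_zero _ ht0), fun i => ?_⟩
    have htn : (t ^ n j') ^ D.weight i ≠ 0 := pow_ne_zero _ (pow_ne_zero _ ht0)
    rw [div_pow, div_mul_eq_mul_div, eq_div_iff htn, mul_comm _ ((t ^ n j') ^ D.weight i)]
    exact hsQ i
  choose J hJ using hF0
  refine ⟨Quotient.lift (fun Q => Point.mk (val (J Q) Q (hJ Q))) ?_, fun j Q h =>
    ⟨val j Q h, fun i => rfl, hval (J Q) j Q (hJ Q) h⟩⟩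
  rintro Q Q' ⟨s, hs⟩
  have hQ' : ∀ j i, aeval Q'.1 (F j i) =
      ((s : AlgebraicClosure k) ^ n j) ^ D.weight i * aeval Q.1 (F j i) := fun j i => by
    rw [show Q'.1 = _ from funext hs, (hF j i).aeval_pow_mul, pow_mul]
  have h' : ∃ i, aeval Q.1 (F (J Q') i) ≠ 0 := by
    obtain ⟨i, hi⟩ := hJ Q'
    exact ⟨i, fun h0 => hi (by rw [hQ', h0, mul_zero])⟩
  refine (hval (J Q) (J Q') Q (hJ Q) h').trans ?_
  exact Point.mk_eq_mk.2 ⟨_, pow_ne_zero _ s.ne_zero, fun i => hQ' (J Q') i⟩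

theorem leftInverse_of_charts {φ : C.Point → D.Point} {ψ : D.Point → C.Point} {ι κ : Type*}
    {F : ι → Fin 3 → MvPolynomial (Fin 3) k} {G : κ → Fin 3 → MvPolynomial (Fin 3) k}
    (hF0 : ∀ Q : C.Cone (AlgebraicClosure k), ∃ j i, aeval Q.1 (F j i) ≠ 0)
    (hG0 : ∀ R : D.Cone (AlgebraicClosure k), ∃ l i, aeval R.1 (G l i) ≠ 0)
    (hφ : ∀ j Q, (∃ i, aeval Q.1 (F j i) ≠ 0) → ∃ R : D.Cone (AlgebraicClosure k),
      (∀ i, R.1 i = aeval Q.1 (F j i)) ∧ φ (Point.mk Q) = Point.mk R)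
    (hψ : ∀ l R, (∃ i, aeval R.1 (G l i) ≠ 0) → ∃ Q : C.Cone (AlgebraicClosure k),
      (∀ i, Q.1 i = aeval R.1 (G l i)) ∧ ψ (Point.mk R) = Point.mk Q)
    (hGF : ∀ j l (Q : C.Cone (AlgebraicClosure k)), ∃ t : AlgebraicClosure k, ∀ i,
      aeval (fun i' => aeval Q.1 (F j i')) (G l i) = t ^ C.weight i * Q.1 i) :
    Function.LeftInverse ψ φ := by
  intro P
  obtain ⟨Q, rfl⟩ := P.exists_rep
  obtain ⟨j, i, hi⟩ := hF0 Q
  obtain ⟨R, hR, hφR⟩ := hφ j Q ⟨i, hi⟩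
  obtain ⟨l, i', hi'⟩ := hG0 R
  obtain ⟨S, hS, hψS⟩ := hψ l R ⟨i', hi'⟩
  obtain ⟨t, ht⟩ := hGF j l Q
  rw [hφR, hψS]
  have hSt : ∀ i, S.1 i = t ^ C.weight i * Q.1 i := fun i => by
    rw [hS, ← ht, show R.1 = _ from funext hR]
  refine (Point.mk_eq_mk.2 ⟨t, fun h0 => S.2.1 ?_, hSt⟩).symm
  ext i
  rw [hSt, h0, zero_pow (C.weight_pos i).ne', zero_mul, Pi.zero_apply]

/-- Two families of polynomial charts which are everywhere mutually inverse up to scaling glue to an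
isomorphism of curves. -/
theorem exists_isIso_of_charts {ι κ : Type*}
    (n : ι → ℕ) (F : ι → Fin 3 → MvPolynomial (Fin 3) k)
    (m : κ → ℕ) (G : κ → Fin 3 → MvPolynomial (Fin 3) k)
    (hF : ∀ j i, (F j i).IsWeightedHomogeneous C.weight (n j * D.weight i))
    (hG : ∀ l i, (G l i).IsWeightedHomogeneous D.weight (m l * C.weight i))
    (hFD : ∀ j (Q : C.Cone (AlgebraicClosure k)), aeval (fun i => aeval Q.1 (F j i)) D.poly = 0)
    (hGC : ∀ l (R : D.Cone (AlgebraicClosure k)), aeval (fun i => aeval R.1 (G l i)) C.poly = 0)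
    (hF0 : ∀ Q : C.Cone (AlgebraicClosure k), ∃ j i, aeval Q.1 (F j i) ≠ 0)
    (hG0 : ∀ R : D.Cone (AlgebraicClosure k), ∃ l i, aeval R.1 (G l i) ≠ 0)
    (hGF : ∀ j l (Q : C.Cone (AlgebraicClosure k)), ∃ t : AlgebraicClosure k, ∀ i,
      aeval (fun i' => aeval Q.1 (F j i')) (G l i) = t ^ C.weight i * Q.1 i)
    (hFG : ∀ j l (R : D.Cone (AlgebraicClosure k)), ∃ t : AlgebraicClosure k, ∀ i,
      aeval (fun i' => aeval R.1 (G l i')) (F j i) = t ^ D.weight i * R.1 i) :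
    ∃ φ : C.Point ≃ D.Point, IsIso φ ∧ ∀ j (Q : C.Cone (AlgebraicClosure k)) R,
      (∀ i, R.1 i = aeval Q.1 (F j i)) → φ (Point.mk Q) = Point.mk R := by
  obtain ⟨φ, hφ⟩ := exists_map_of_charts n F G hF hFD hF0 hG0 hGF hFG
  obtain ⟨ψ, hψ⟩ := exists_map_of_charts m G F hG hGC hG0 hF0
    (fun l j R => hFG j l R) (fun l j Q => hGF j l Q)
  have h1 : Function.LeftInverse ψ φ := leftInverse_of_charts hF0 hG0 hφ hψ hGF
  have h2 : Function.LeftInverse φ ψ := leftInverse_of_charts hG0 hF0 hψ hφ fun l j => hFG j l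
  refine ⟨⟨φ, ψ, h1, h2⟩, ⟨fun P => ?_, fun P => ?_⟩, ?_⟩
  · obtain ⟨j, hj⟩ := hF0 P
    exact ⟨n j, F j, hF j, hj, hφ j⟩
  · obtain ⟨l, hl⟩ := hG0 P
    exact ⟨m l, G l, hG l, hl, hψ l⟩
  · intro j Q R hR
    obtain ⟨i, hi⟩ := Function.ne_iff.1 R.2.1
    rw [Pi.zero_apply] at hi
    obtain ⟨R', hR', h⟩ := hφ j Q ⟨i, by rwa [← hR i]⟩
    have hRR : R' = R := by
      apply Subtype.ext
      ext i
      rw [hR', hR]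
    rw [← hRR]
    exact h

end WeightedPlaneCurve

/-! ### Coordinate rings of affine curves `w² = h(t)` -/

namespace QuadraticAlgebra

open Polynomial hiding C X

variable {k : Type*} [Field k]

theorem eq_zero_of_norm_eq_zero {h : k[X]} (hsq : ¬ IsSquare h) {z : QuadraticAlgebra k[X] h 0}
    (hz : z.norm = 0) : z = 0 := by
  have h1 : z.re ^ 2 = h * z.im ^ 2 := by
    rw [norm_def] at hz
    linear_combination hz
  by_cases hb : z.im = 0
  · have : z.re = 0 := by simpa [hb] using h1
    ext1
    · exact this
    · exact hb
  · obtain ⟨c, hc⟩ := (IsIntegrallyClosed.pow_dvd_pow_iff two_ne_zero).1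
      (Dvd.intro_left h h1.symm : z.im ^ 2 ∣ z.re ^ 2)
    refine absurd ⟨c, ?_⟩ hsq
    refine mul_right_cancel₀ (pow_ne_zero 2 hb) ?_
    rw [← h1, hc]; ring

theorem isDomain_of_not_isSquare {h : k[X]} (hsq : ¬ IsSquare h) :
    IsDomain (QuadraticAlgebra k[X] h 0) := by
  have : NoZeroDivisors (QuadraticAlgebra k[X] h 0) := ⟨fun {x y} hxy => by
    have := congrArg norm hxy
    rw [map_mul, norm_zero, mul_eq_zero] at this
    exact this.imp (eq_zero_of_norm_eq_zero hsq) (eq_zero_of_norm_eq_zero hsq)⟩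
  exact NoZeroDivisors.to_isDomain _

/-- The degree of the divisor of zeros of a function on an affine curve `w² = h` is the degree of its
norm. -/
theorem finrank_quotient_span_singleton {h : k[X]} [IsDomain (QuadraticAlgebra k[X] h 0)]
    {z : QuadraticAlgebra k[X] h 0} (hz : z ≠ 0) :
    Module.finrank k (QuadraticAlgebra k[X] h 0 ⧸ Ideal.span {z}) = z.norm.natDegree := by
  rw [finrank_quotient_span_eq_natDegree_norm (basis h 0) hz, ← det_toLinearMap_eq_norm,
    Algebra.norm_apply]
  rfl

/-- A function `a + b √h` all of whose translates by constants have a norm of degree `2`, or all of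
degree at most `1`, is a linear polynomial. If `b ≠ 0`, then `b² h` has degree at least `3`, so that
cancellation in the norm `(a - c)² - b² h` forces `deg a = 2`; but then the coefficient of `t²` in the
norm is a nonconstant affine function of `c`, and vanishes for exactly one `c`. -/
theorem im_eq_zero_of_natDegree_norm {h : k[X]} (h2 : (2 : k) ≠ 0) (hdeg : 3 ≤ h.natDegree)
    {z : QuadraticAlgebra k[X] h 0}
    (hz : (∀ c : k, (z - algebraMap k _ c).norm.natDegree = 2) ∨
      ∀ c : k, (z - algebraMap k _ c).norm.natDegree ≤ 1) :
    z.im = 0 ∧ z.re.natDegree ≤ 1 := by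
  have hN : ∀ c : k, (z - algebraMap k _ c).norm
      = z.norm - Polynomial.C (2 * c) * z.re + Polynomial.C (c ^ 2) := fun c => by
    have : algebraMap k (QuadraticAlgebra k[X] h 0) c = ⟨Polynomial.C c, 0⟩ := rfl
    rw [norm_def, norm_def, this]
    simp only [re_sub, im_sub, Polynomial.C_mul, Polynomial.C_pow]
    rw [show (Polynomial.C 2 : k[X]) = 2 from rfl]
    ring
  have hN0 : z.norm = z.re ^ 2 - h * z.im ^ 2 := by rw [norm_def]; ring
  have hle : ∀ c : k, (z - algebraMap k _ c).norm.natDegree ≤ 2 := fun c => by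
    rcases hz with hz | hz
    · exact (hz c).le
    · exact (hz c).trans one_le_two
  have hle0 : z.norm.natDegree ≤ 2 := by simpa using hle 0
  have ha : z.re.natDegree ≤ 2 := by
    have h1 : Polynomial.C (2 : k) * z.re =
        z.norm - (z - algebraMap k _ (1 : k)).norm + Polynomial.C 1 := by
      rw [hN, mul_one, one_pow, Polynomial.C_1]; ring
    rw [← natDegree_C_mul h2, h1]
    refine (natDegree_add_le _ _).trans (max_le ((natDegree_sub_le _ _).trans
      (max_le hle0 (hle 1))) (by simp))
  have hb : z.im = 0 := by
    by_contra hb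
    have hhb : h * z.im ^ 2 = z.re ^ 2 - z.norm := by rw [hN0]; ring
    have hd : (h * z.im ^ 2).natDegree = h.natDegree + 2 * z.im.natDegree := by
      rw [natDegree_mul (by rintro rfl; simp at hdeg) (pow_ne_zero 2 hb), natDegree_pow]
    have hc2 : ∀ c : k, (z - algebraMap k _ c).norm.coeff 2
        = z.norm.coeff 2 - 2 * c * z.re.coeff 2 := fun c => by
      rw [hN, Polynomial.coeff_add, Polynomial.coeff_sub, Polynomial.coeff_C_mul, Polynomial.coeff_C]
      simp
    have ha2 : z.re.coeff 2 = 0 := by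
      by_contra ha2
      rcases hz with hz | hz
      · have h1 := hc2 (z.norm.coeff 2 / (2 * z.re.coeff 2))
        have h3 : (z - algebraMap k _ (z.norm.coeff 2 / (2 * z.re.coeff 2))).norm ≠ 0 := by
          intro h0
          have := hz (z.norm.coeff 2 / (2 * z.re.coeff 2))
          rw [h0] at this
          simp at this
        refine leadingCoeff_ne_zero.2 h3 ?_
        rw [leadingCoeff, hz, h1]
        field_simp
        ring
      · have h1 := hc2 1
        have h0 := hc2 0
        rw [coeff_eq_zero_of_natDegree_lt (by have := hz 1; omega)] at h1
        rw [coeff_eq_zero_of_natDegree_lt (by have := hz 0; omega)] at h0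
        have : 2 * z.re.coeff 2 = 0 := by linear_combination h1 - h0
        exact (mul_ne_zero h2 ha2) this
    have ha1 : z.re.natDegree ≤ 1 := by
      rw [natDegree_le_iff_coeff_eq_zero]
      intro N hN
      rcases (show N = 2 ∨ 2 < N by omega) with rfl | hN
      · exact ha2
      · exact coeff_eq_zero_of_natDegree_lt (by omega)
    have : (h * z.im ^ 2).natDegree ≤ 2 := by
      rw [hhb]
      refine (natDegree_sub_le _ _).trans (max_le ?_ hle0)
      rw [natDegree_pow]; omega
    omega
  refine ⟨hb, ?_⟩
  have : (z.re ^ 2).natDegree ≤ 2 := by simpa [hN0, hb] using hle0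
  rw [natDegree_pow] at this
  omega

/-- An isomorphism between the affine coordinate rings of `w² = f` and `w² = h` is induced by an
affine change of `x` and a scaling of `w`. The image of `x` is found from the degrees of the divisors
of zeros of `x - c`, which are all `2`. -/
theorem exists_linear_of_algEquiv {f h : k[X]} (h2 : (2 : k) ≠ 0) (hdeg : 3 ≤ h.natDegree)
    (hsq : ¬ IsSquare h) (θ : QuadraticAlgebra k[X] f 0 ≃ₐ[k] QuadraticAlgebra k[X] h 0) :
    ∃ α β e : k, α ≠ 0 ∧ e ≠ 0 ∧
      θ ⟨Polynomial.X, 0⟩ = ⟨Polynomial.C α * Polynomial.X + Polynomial.C β, 0⟩ ∧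
      θ ⟨0, 1⟩ = ⟨0, Polynomial.C e⟩ := by
  have := isDomain_of_not_isSquare hsq
  have : IsDomain (QuadraticAlgebra k[X] f 0) := θ.toMulEquiv.isDomain _
  have hne : ∀ c : k, (⟨Polynomial.X, 0⟩ - algebraMap k _ c : QuadraticAlgebra k[X] f 0) ≠ 0 := by
    intro c h0
    have := congrArg re h0
    exact X_sub_C_ne_zero c this
  obtain ⟨h1, h3⟩ := im_eq_zero_of_natDegree_norm (z := θ ⟨Polynomial.X, 0⟩) h2 hdeg
    (Or.inl fun c => by
    have hθ : θ ⟨Polynomial.X, 0⟩ - algebraMap k _ c = θ (⟨Polynomial.X, 0⟩ - algebraMap k _ c) := by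
      rw [map_sub, θ.commutes]
    have e := (Ideal.quotientEquivAlg (Ideal.span {⟨Polynomial.X, 0⟩ - algebraMap k _ c})
      (Ideal.span {θ (⟨Polynomial.X, 0⟩ - algebraMap k _ c)}) θ
      (by rw [Ideal.map_span, Set.image_singleton]; rfl)).toLinearEquiv.finrank_eq
    rw [hθ, ← finrank_quotient_span_singleton ((map_ne_zero_iff _ θ.injective).2 (hne c)),
      ← e, finrank_quotient_span_singleton (hne c)]
    have : (⟨Polynomial.X, 0⟩ - algebraMap k _ c : QuadraticAlgebra k[X] f 0).norm
        = (Polynomial.X - Polynomial.C c) ^ 2 := by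
      rw [show algebraMap k (QuadraticAlgebra k[X] f 0) c = ⟨Polynomial.C c, 0⟩ from rfl]
      simp [norm_def]
      ring
    rw [this, natDegree_pow, natDegree_X_sub_C])
  set p := (θ ⟨Polynomial.X, 0⟩).re with hp
  have hX : θ ⟨Polynomial.X, 0⟩ = algebraMap k[X] _ p := by
    ext1
    · rfl
    · exact h1
  have hC : ∀ q : k[X], θ (algebraMap k[X] _ q) = algebraMap k[X] _ (q.comp p) := fun q => by
    have : ((θ : QuadraticAlgebra k[X] f 0 →ₐ[k] _).comp
        (IsScalarTower.toAlgHom k k[X] (QuadraticAlgebra k[X] f 0))) =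
        (IsScalarTower.toAlgHom k k[X] (QuadraticAlgebra k[X] h 0)).comp (Polynomial.aeval p) :=
      Polynomial.algHom_ext (by
        simp only [AlgHom.comp_apply, IsScalarTower.coe_toAlgHom', Polynomial.aeval_X]
        exact hX)
    exact congrArg (fun g : k[X] →ₐ[k] _ => g q) this
  -- `θ ω` squares to a polynomial in `x`, so it is a polynomial in `x` or a multiple of `ω`
  obtain ⟨u, hu⟩ := θ.surjective ⟨0, 1⟩
  have hu' : u = algebraMap k[X] _ u.re + algebraMap k[X] _ u.im * ⟨0, 1⟩ := by
    ext1 <;> simp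
  rw [hu', map_add, map_mul, hC, hC] at hu
  have hre := congrArg re hu
  have him := congrArg im hu
  simp at hre him
  have hsq' : θ ⟨0, 1⟩ * θ ⟨0, 1⟩ = algebraMap k[X] _ (f.comp p) := by
    rw [← map_mul, ← hC]
    congr 1
    ext1 <;> simp
  have him2 := congrArg im hsq'
  simp at him2
  obtain ⟨e, he, hs⟩ := Polynomial.isUnit_iff.1 (IsUnit.of_mul_eq_one_right _ him)
  have hr : (θ ⟨0, 1⟩).re = 0 := by
    rw [← hs] at him2
    have h22 : Polynomial.C (2 * e) * (θ ⟨0, 1⟩).re = 0 := by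
      rw [Polynomial.C_mul, show (Polynomial.C 2 : k[X]) = 2 from rfl]
      linear_combination him2
    exact (mul_eq_zero.1 h22).resolve_left
      (Polynomial.C_ne_zero.2 (mul_ne_zero h2 he.ne_zero))
  obtain ⟨α, β, hαβ⟩ := Polynomial.exists_eq_X_add_C_of_natDegree_le_one h3
  refine ⟨α, β, e, ?_, he.ne_zero, ?_, ?_⟩
  · rintro rfl
    refine (map_ne_zero_iff _ θ.injective).2 (hne β) ?_
    rw [map_sub, θ.commutes, hX, hαβ, show algebraMap k (QuadraticAlgebra k[X] h 0) β
      = algebraMap k[X] _ (Polynomial.C β) from rfl, ← map_sub]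
    simp
  · ext1
    · exact hαβ
    · exact h1
  · ext1
    · exact hr
    · exact hs.symm

/-- The coordinate ring of `w² = h` is not a quotient of a polynomial ring in one variable. -/
theorem not_surjective_of_polynomial {h : k[X]} (h2 : (2 : k) ≠ 0) (hdeg : 3 ≤ h.natDegree)
    (hsq : ¬ IsSquare h) (θ : k[X] →ₐ[k] QuadraticAlgebra k[X] h 0) :
    ¬ Function.Surjective θ := by
  intro hθ
  have := isDomain_of_not_isSquare hsq
  obtain ⟨h1, h3⟩ := im_eq_zero_of_natDegree_norm (z := θ Polynomial.X) h2 hdeg (Or.inr fun c => by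
    have hc : θ Polynomial.X - algebraMap k _ c = θ (Polynomial.X - Polynomial.C c) := by
      rw [map_sub, ← Polynomial.algebraMap_eq, θ.commutes]
    rw [hc]
    by_cases h0 : θ (Polynomial.X - Polynomial.C c) = 0
    · simp [h0]
    rw [← finrank_quotient_span_singleton h0,
      ← (finrank_quotient_span_eq_natDegree (f := (Polynomial.X - Polynomial.C c : k[X]))).trans
        (natDegree_X_sub_C c)]
    have hfin : Module.Finite k (k[X] ⧸ Ideal.span {Polynomial.X - Polynomial.C c}) := by
      refine Module.finite_of_finrank_eq_succ (n := 0) ?_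
      exact finrank_quotient_span_eq_natDegree.trans (natDegree_X_sub_C c)
    let g := Ideal.quotientMapₐ (I := Ideal.span {Polynomial.X - Polynomial.C c})
      (Ideal.span {θ (Polynomial.X - Polynomial.C c)}) θ
      (by rw [Ideal.span_le, Set.singleton_subset_iff]; exact Ideal.mem_span_singleton_self _)
    refine LinearMap.finrank_le_finrank_of_surjective (f := g.toLinearMap) ?_
    intro y
    obtain ⟨y, rfl⟩ := Ideal.Quotient.mk_surjective y
    obtain ⟨x, rfl⟩ := hθ y
    exact ⟨Ideal.Quotient.mk _ x, rfl⟩)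
  obtain ⟨q, hq⟩ := hθ ⟨0, 1⟩
  have hX : θ Polynomial.X = algebraMap k[X] _ (θ Polynomial.X).re := by
    ext1
    · rfl
    · exact h1
  have : θ = (IsScalarTower.toAlgHom k k[X] (QuadraticAlgebra k[X] h 0)).comp
      (Polynomial.aeval (θ Polynomial.X).re) :=
    Polynomial.algHom_ext (by
      simp only [AlgHom.comp_apply, IsScalarTower.coe_toAlgHom', Polynomial.aeval_X]
      exact hX)
  rw [this] at hq
  have := congrArg im hq
  simp at this

end QuadraticAlgebra

/-! ### Linear maps between quartic curves -/

namespace QuarticCurve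

open WeightedPlaneCurve

variable {k : Type*} [Field k] {f h l : homogeneousSubmodule (Fin 2) k 4}

theorem aeval_poly {K : Type*} [Field K] [Algebra k K] (v : Fin 3 → K) :
    aeval v (quarticCurve f).poly = v 2 ^ 2 - aeval ![v 0, v 1] f.1 := by
  have : aeval v (aeval ![X 0, X 1] f.1 : MvPolynomial (Fin 3) k) = aeval ![v 0, v 1] f.1 := by
    rw [← AlgHom.comp_apply, comp_aeval]
    congr 2
    ext i
    fin_cases i <;> simp
  simp only [quarticCurve, map_sub, map_pow, aeval_X, this]

theorem cone_sq (Q : (quarticCurve f).Cone (AlgebraicClosure k)) :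
    Q.1 2 ^ 2 = aeval ![Q.1 0, Q.1 1] f.1 :=
  sub_eq_zero.1 ((aeval_poly Q.1).symm.trans Q.2.2)

theorem form_smul {K : Type*} [Field K] [Algebra k K] (t x y : K) :
    aeval ![t * x, t * y] f.1 = t ^ 4 * aeval ![x, y] f.1 := by
  have hf : f.1.IsWeightedHomogeneous 1 4 := f.2
  have := hf.aeval_pow_mul t ![x, y]
  rw [← this]
  congr 2
  ext i
  fin_cases i <;> simp

theorem form_zero {K : Type*} [Field K] [Algebra k K] : aeval ![(0 : K), 0] f.1 = 0 := by
  simpa using form_smul (f := f) (0 : K) 0 0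

theorem cone_ne_zero (Q : (quarticCurve f).Cone (AlgebraicClosure k)) :
    Q.1 0 ≠ 0 ∨ Q.1 1 ≠ 0 := by
  by_contra! h0
  have h2 := cone_sq Q
  rw [h0.1, h0.2, form_zero] at h2
  refine Q.2.1 (funext fun i => ?_)
  fin_cases i
  · exact h0.1
  · exact h0.2
  · exact pow_eq_zero_iff two_ne_zero |>.1 h2

/-- The coordinate vector `(x, y, w)` on the curve `w² = f(x, y)`. -/
def coneMk (f : homogeneousSubmodule (Fin 2) k 4) (x y w : AlgebraicClosure k)
    (h0 : x ≠ 0 ∨ y ≠ 0) (hw : w ^ 2 = aeval ![x, y] f.1) :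
    (quarticCurve f).Cone (AlgebraicClosure k) :=
  ⟨![x, y, w], fun h => by
    have h1 := congrFun h 0
    have h2 := congrFun h 1
    simp only [Matrix.cons_val_zero, Matrix.cons_val_one, Pi.zero_apply] at h1 h2
    exact h0.elim (fun h => h h1) (fun h => h h2), by
    rw [aeval_poly]
    exact sub_eq_zero.2 hw⟩

theorem exists_sq (f : homogeneousSubmodule (Fin 2) k 4) (x y : AlgebraicClosure k) :
    ∃ w : AlgebraicClosure k, w ^ 2 = aeval ![x, y] f.1 :=
  IsAlgClosed.exists_pow_nat_eq _ two_pos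

theorem form_ext (H : ∀ x y : AlgebraicClosure k, aeval ![x, y] f.1 = aeval ![x, y] h.1) :
    f = h := by
  apply Subtype.ext
  apply map_injective _ (algebraMap k (AlgebraicClosure k)).injective
  refine funext fun v => ?_
  have := H (v 0) (v 1)
  rw [show ![v 0, v 1] = v by ext i; fin_cases i <;> rfl] at this
  rwa [eval_map, eval_map]

theorem mk_eq_mk {Q R : (quarticCurve f).Cone (AlgebraicClosure k)} :
    Point.mk Q = Point.mk R ↔ ∃ t : AlgebraicClosure k, t ≠ 0 ∧ R.1 0 = t * Q.1 0 ∧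
      R.1 1 = t * Q.1 1 ∧ R.1 2 = t ^ 2 * Q.1 2 := by
  rw [Point.mk_eq_mk]
  refine exists_congr fun t => and_congr_right fun _ => ?_
  rw [Fin.forall_fin_succ, Fin.forall_fin_two]
  simp [quarticCurve]

/-- The form `c · f(g(x, y))`. -/
noncomputable def formSubst (g : Matrix (Fin 2) (Fin 2) k) (c : k)
    (f : homogeneousSubmodule (Fin 2) k 4) : homogeneousSubmodule (Fin 2) k 4 :=
  ⟨C c * bind₁ (fun i => C (g i 0) * X 0 + C (g i 1) * X 1) f.1, by
    have hf : f.1.IsWeightedHomogeneous 1 4 := f.2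
    refine IsWeightedHomogeneous.C_mul (hf.bind₁ (n := 1) fun i => ?_) c
    exact ((isHomogeneous_X k 0).C_mul _).add ((isHomogeneous_X k 1).C_mul _)⟩

theorem aeval_formSubst {K : Type*} [Field K] [Algebra k K] (g : Matrix (Fin 2) (Fin 2) k) (c : k)
    (x y : K) : aeval ![x, y] (formSubst g c f).1 = algebraMap k K c *
      aeval ![algebraMap k K (g 0 0) * x + algebraMap k K (g 0 1) * y,
        algebraMap k K (g 1 0) * x + algebraMap k K (g 1 1) * y] f.1 := by
  rw [formSubst, map_mul, aeval_C, aeval_bind₁]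
  congr 3
  ext i
  fin_cases i <;> simp

/-- The linear map `(x, y, w) ↦ (g(x, y), e w)`. -/
noncomputable def linVec (g : Matrix (Fin 2) (Fin 2) k) (e : k) (v : Fin 3 → AlgebraicClosure k) :
    Fin 3 → AlgebraicClosure k :=
  ![algebraMap k _ (g 0 0) * v 0 + algebraMap k _ (g 0 1) * v 1,
    algebraMap k _ (g 1 0) * v 0 + algebraMap k _ (g 1 1) * v 1, algebraMap k _ e * v 2]

theorem linVec_linVec (g g' : Matrix (Fin 2) (Fin 2) k) (e e' : k)
    (v : Fin 3 → AlgebraicClosure k) :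
    linVec g e (linVec g' e' v) = linVec (g * g') (e * e') v := by
  ext i
  fin_cases i <;> simp [linVec, Matrix.mul_apply, Fin.sum_univ_two] <;> ring

theorem linVec_one (v : Fin 3 → AlgebraicClosure k) : linVec 1 1 v = v := by
  ext i
  fin_cases i <;> simp [linVec]

/-- A map between the geometric points of two curves `w² = f` and `w² = h` is linear, given by an
invertible matrix `g` and a scalar `e`, if it is `[x : y : w] ↦ [g(x, y) : e w]`. -/
def IsLinear (g : GL (Fin 2) k) (e : kˣ) (φ : (quarticCurve f).Point ≃ (quarticCurve h).Point) :
    Prop :=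
  ∀ Q, ∃ R : (quarticCurve h).Cone (AlgebraicClosure k),
    R.1 = linVec g.1 e Q.1 ∧ φ (Point.mk Q) = Point.mk R

variable {g g' : GL (Fin 2) k} {e e' : kˣ}

theorem IsLinear.trans {φ : (quarticCurve f).Point ≃ (quarticCurve h).Point}
    {ψ : (quarticCurve h).Point ≃ (quarticCurve l).Point} (hφ : IsLinear g e φ)
    (hψ : IsLinear g' e' ψ) : IsLinear (g' * g) (e' * e) (φ.trans ψ) := by
  intro Q
  obtain ⟨R, hR, h1⟩ := hφ Q
  obtain ⟨S, hS, h2⟩ := hψ R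
  exact ⟨S, by rw [hS, hR, linVec_linVec]; rfl, by rw [Equiv.trans_apply, h1, h2]⟩

theorem IsLinear.ext {φ φ' : (quarticCurve f).Point ≃ (quarticCurve h).Point}
    (hφ : IsLinear g e φ) (hφ' : IsLinear g e φ') : φ = φ' := by
  ext P
  obtain ⟨Q, rfl⟩ := P.exists_rep
  obtain ⟨R, hR, h1⟩ := hφ Q
  obtain ⟨S, hS, h2⟩ := hφ' Q
  rw [h1, h2]
  congr 1
  exact Subtype.ext (hR.trans hS.symm)

theorem IsLinear.aeval_eq {φ : (quarticCurve f).Point ≃ (quarticCurve h).Point}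
    (hφ : IsLinear g e φ) : formSubst g.1 ((e : k) ^ 2)⁻¹ h = f := by
  refine form_ext fun x y => ?_
  by_cases h0 : x ≠ 0 ∨ y ≠ 0
  · obtain ⟨w, hw⟩ := exists_sq f x y
    obtain ⟨R, hR, -⟩ := hφ (coneMk f x y w h0 hw)
    have := cone_sq R
    rw [hR] at this
    simp only [linVec, coneMk, Matrix.cons_val_zero, Matrix.cons_val_one, Matrix.cons_val] at this
    rw [aeval_formSubst, ← this, ← hw, map_inv₀, map_pow]
    have he : algebraMap k (AlgebraicClosure k) e ≠ 0 := by simp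
    field_simp
  · push Not at h0
    rw [h0.1, h0.2, form_zero, form_zero]

theorem linVec_homogeneous (e : k) (g : Matrix (Fin 2) (Fin 2) k) :
    ∃ F : Fin 3 → MvPolynomial (Fin 3) k,
      (∀ i, (F i).IsWeightedHomogeneous ![1, 1, 2] (1 * (![1, 1, 2] : Fin 3 → ℕ) i)) ∧
      ∀ v : Fin 3 → AlgebraicClosure k, (fun i => aeval v (F i)) = linVec g e v := by
  refine ⟨![C (g 0 0) * X 0 + C (g 0 1) * X 1, C (g 1 0) * X 0 + C (g 1 1) * X 1, C e * X 2],
    fun i => ?_, fun v => ?_⟩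
  · have h0 := isWeightedHomogeneous_X k ![1, 1, 2] (0 : Fin 3)
    have h1 := isWeightedHomogeneous_X k ![1, 1, 2] (1 : Fin 3)
    have h2 := isWeightedHomogeneous_X k ![1, 1, 2] (2 : Fin 3)
    fin_cases i
    · exact (h0.C_mul _).add (h1.C_mul _)
    · exact (h0.C_mul _).add (h1.C_mul _)
    · exact h2.C_mul _
  · ext i
    fin_cases i <;> simp [linVec]

theorem linVec_inv (g : GL (Fin 2) k) (e : kˣ) (v : Fin 3 → AlgebraicClosure k) :
    linVec (g⁻¹ : GL (Fin 2) k).1 (e⁻¹ : kˣ) (linVec g.1 e v) = v := by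
  rw [linVec_linVec, ← Units.val_mul, ← Units.val_mul, inv_mul_cancel, inv_mul_cancel,
    Units.val_one, Units.val_one, linVec_one]

theorem linVec_inv' (g : GL (Fin 2) k) (e : kˣ) (v : Fin 3 → AlgebraicClosure k) :
    linVec g.1 e (linVec (g⁻¹ : GL (Fin 2) k).1 (e⁻¹ : kˣ) v) = v := by
  simpa using linVec_inv g⁻¹ e⁻¹ v

theorem aeval_poly_linVec (g : GL (Fin 2) k) (e : kˣ) (v : Fin 3 → AlgebraicClosure k) :
    aeval (linVec g.1 e v) (quarticCurve h).poly = algebraMap k _ ((e : k) ^ 2) *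
      aeval v (quarticCurve (formSubst g.1 ((e : k) ^ 2)⁻¹ h)).poly := by
  rw [aeval_poly, aeval_poly, aeval_formSubst]
  simp only [linVec, Matrix.cons_val_zero, Matrix.cons_val_one, Matrix.cons_val]
  have he : algebraMap k (AlgebraicClosure k) e ≠ 0 := by simp
  rw [map_inv₀, map_pow]
  field_simp

/-- Every pair `(g, e)` induces a linear isomorphism onto `w² = h`. -/
theorem exists_isLinear (h : homogeneousSubmodule (Fin 2) k 4) (g : GL (Fin 2) k) (e : kˣ) :
    ∃ φ : (quarticCurve (formSubst g.1 ((e : k) ^ 2)⁻¹ h)).Point ≃ (quarticCurve h).Point,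
      IsIso φ ∧ IsLinear g e φ := by
  obtain ⟨F, hF, hF'⟩ := linVec_homogeneous (e : k) g.1
  obtain ⟨G, hG, hG'⟩ := linVec_homogeneous ((e⁻¹ : kˣ) : k) (g⁻¹ : GL (Fin 2) k).1
  have hz : ∀ (g : GL (Fin 2) k) (e : kˣ) (v : Fin 3 → AlgebraicClosure k),
      linVec g.1 e v = 0 → v = 0 := fun g e v hv => by
    rw [← linVec_inv g e v, hv]
    ext i
    fin_cases i <;> simp [linVec]
  have he : algebraMap k (AlgebraicClosure k) ((e : k) ^ 2) ≠ 0 := by simp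
  have hcone : ∀ Q : (quarticCurve (formSubst g.1 ((e : k) ^ 2)⁻¹ h)).Cone (AlgebraicClosure k),
      linVec g.1 e Q.1 ≠ 0 ∧ aeval (linVec g.1 e Q.1) (quarticCurve h).poly = 0 := fun Q =>
    ⟨fun h0 => Q.2.1 (hz _ _ _ h0), by rw [aeval_poly_linVec, Q.2.2, mul_zero]⟩
  obtain ⟨φ, hφ, hφ'⟩ := exists_isIso_of_charts (C := quarticCurve (formSubst g.1 _ h))
    (D := quarticCurve h) (ι := Unit) (κ := Unit) (fun _ => 1) (fun _ => F) (fun _ => 1)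
    (fun _ => G) (fun _ => hF) (fun _ => hG)
    (fun _ Q => by rw [hF']; exact (hcone Q).2)
    (fun _ R => by
      rw [hG']
      refine (mul_eq_zero.1 ?_).resolve_left he
      rw [← aeval_poly_linVec, linVec_inv', R.2.2])
    (fun Q => ⟨(), by
      by_contra! h0
      exact Q.2.1 (hz g e _ (by rw [← hF']; exact funext h0))⟩)
    (fun R => ⟨(), by
      by_contra! h0
      exact R.2.1 (hz _ _ _ (by rw [← hG']; exact funext h0))⟩)
    (fun _ _ Q => ⟨1, fun i => by
      rw [hF', one_pow, one_mul, ← congrFun (linVec_inv g e Q.1) i, ← hG']⟩)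
    (fun _ _ R => ⟨1, fun i => by
      rw [hG', one_pow, one_mul, ← congrFun (linVec_inv' g e R.1) i, ← hF']⟩)
  refine ⟨φ, hφ, fun Q => ⟨⟨_, hcone Q⟩, rfl, hφ' () Q _ fun i => ?_⟩⟩
  exact (congrFun (hF' Q.1) i).symm

theorem IsLinear.symm {φ : (quarticCurve f).Point ≃ (quarticCurve h).Point}
    (hφ : IsLinear g e φ) : IsLinear g⁻¹ e⁻¹ φ.symm := by
  intro R
  obtain ⟨Q, hQ⟩ := (φ.symm (Point.mk R)).exists_rep
  obtain ⟨R', hR', h1⟩ := hφ Q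
  rw [hQ, Equiv.apply_symm_apply] at h1
  obtain ⟨t, ht, hR⟩ := Point.mk_eq_mk.1 h1.symm
  obtain ⟨Q', h2, h3⟩ := exists_mk_eq (v := Q) (u := linVec (g⁻¹ : GL (Fin 2) k).1
    (e⁻¹ : kˣ) R.1) ht fun i => by
      rw [show R.1 = _ from funext hR, hR']
      have h4 := congrFun (linVec_inv g e Q.1) i
      rw [← h4]
      fin_cases i <;> simp [linVec, quarticCurve] <;> first | ring1 | field_simp
  exact ⟨Q', h2, by rw [← hQ, h3]⟩

theorem IsLinear.isIso {φ : (quarticCurve f).Point ≃ (quarticCurve h).Point}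
    (hφ : IsLinear g e φ) : IsIso φ := by
  have hf := hφ.aeval_eq
  subst hf
  obtain ⟨ψ, hψ, h1⟩ := exists_isLinear h g e
  rwa [hφ.ext h1]

end QuarticCurve

/-! ### Functions on the points of affine curves `w² = p(t)` -/

namespace QuadraticAlgebra

open Polynomial hiding C X

variable {k K : Type*} [Field k] [Field K] [Algebra k K]

/-- The `K`-points of the affine curve `w² = p(t)`. -/
abbrev AffinePoint (p : k[X]) (K : Type*) [Field K] [Algebra k K] : Type _ :=
  {q : K × K // q.2 ^ 2 = Polynomial.aeval q.1 p}

/-- The function on the affine curve `w² = p(t)` defined by an element `a + b ω` of its coordinate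
ring. -/
noncomputable def evalHom (p : k[X]) (K : Type*) [Field K] [Algebra k K] :
    QuadraticAlgebra k[X] p 0 →ₐ[k] (AffinePoint p K → K) :=
  AlgHom.ofLinearMap
    { toFun := fun z q => Polynomial.aeval q.1.1 z.re + Polynomial.aeval q.1.1 z.im * q.1.2
      map_add' := fun y z => by ext q; simp; ring
      map_smul' := fun c z => by ext q; simp [smul_add] }
    (by ext q; simp)
    (fun y z => by
      ext q
      have := q.2
      simp
      linear_combination (-Polynomial.aeval q.1.1 y.im * Polynomial.aeval q.1.1 z.im) * this)

theorem evalHom_apply {p : k[X]} (z : QuadraticAlgebra k[X] p 0) (q : AffinePoint p K) :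
    evalHom p K z q = Polynomial.aeval q.1.1 z.re + Polynomial.aeval q.1.1 z.im * q.1.2 := rfl

theorem aeval_comp_evalHom {p : k[X]} (z : QuadraticAlgebra k[X] p 0) (q : AffinePoint p K)
    (a : k[X]) : Polynomial.aeval (evalHom p K z q) a = evalHom p K (Polynomial.aeval z a) q := by
  have := Polynomial.aeval_algHom_apply (evalHom p K) z a
  rw [← this]
  exact (Polynomial.aeval_algHom_apply (Pi.evalAlgHom k (fun _ => K) q) (evalHom p K z) a)

theorem polynomial_eq_zero_of_aeval [IsAlgClosed K] {a : k[X]}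
    (ha : ∀ t : K, t ≠ 0 → Polynomial.aeval t a = 0) : a = 0 := by
  have : Polynomial.X * a = 0 := by
    apply Polynomial.map_injective _ (algebraMap k K).injective
    refine Polynomial.funext fun t => ?_
    by_cases ht : t = 0
    · simp [ht]
    · have := ha t ht
      rw [Polynomial.aeval_def, ← Polynomial.eval_map] at this
      simp [this]
  exact (mul_eq_zero.1 this).resolve_left Polynomial.X_ne_zero

/-- The coordinate ring of `w² = p(t)`, `p ≠ 0`, is a ring of functions; even on the open subset
`t ≠ 0`. -/
theorem eq_zero_of_evalHom [IsAlgClosed K] (h2 : (2 : k) ≠ 0) {p : k[X]} (hp : p ≠ 0)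
    {z : QuadraticAlgebra k[X] p 0} (hz : ∀ q : AffinePoint p K, q.1.1 ≠ 0 → evalHom p K z q = 0) :
    z = 0 := by
  have h2' : (2 : K) ≠ 0 := by
    have := (map_ne_zero (algebraMap k K)).2 h2
    rwa [map_ofNat] at this
  have key : ∀ t : K, t ≠ 0 → Polynomial.aeval t z.re = 0 ∧ Polynomial.aeval t (z.im * p) = 0 := by
    intro t ht
    obtain ⟨w, hw⟩ := IsAlgClosed.exists_pow_nat_eq (Polynomial.aeval t p) two_pos
    have h1 := hz ⟨(t, w), hw⟩ ht
    have h3 := hz ⟨(t, -w), by simpa using hw⟩ ht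
    simp only [evalHom_apply] at h1 h3
    have h4 : Polynomial.aeval t z.re = 0 := by
      refine (mul_eq_zero.1 ?_).resolve_left h2'
      linear_combination h1 + h3
    refine ⟨h4, ?_⟩
    rw [map_mul, ← hw]
    rw [h4] at h1
    linear_combination w * h1
  ext1
  · exact polynomial_eq_zero_of_aeval fun t ht => (key t ht).1
  · exact (mul_eq_zero.1 (polynomial_eq_zero_of_aeval fun t ht => (key t ht).2)).resolve_right hp

theorem evalHom_injective [IsAlgClosed K] (h2 : (2 : k) ≠ 0) {p : k[X]} (hp : p ≠ 0) :
    Function.Injective (evalHom p K) :=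
  (injective_iff_map_eq_zero _).2 fun _ hz =>
    eq_zero_of_evalHom h2 hp fun q _ => congrFun hz q

/-- A function on the geometric points of `w² = p(t)` which is locally a quotient of polynomials
is given by an element of the coordinate ring: by the Nullstellensatz, the ideal of its denominators
is the unit ideal. -/
theorem exists_evalHom_eq [IsAlgClosed K] {p : k[X]} (u : AffinePoint p K → K)
    (hu : ∀ q : AffinePoint p K, ∃ N D : MvPolynomial (Fin 2) k,
      aeval ![q.1.1, q.1.2] D ≠ 0 ∧
      ∀ q' : AffinePoint p K, u q' * aeval ![q'.1.1, q'.1.2] D = aeval ![q'.1.1, q'.1.2] N) :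
    ∃ z, evalHom p K z = u := by
  let I : Ideal (MvPolynomial (Fin 2) k) :=
    { carrier := {D | ∃ N : MvPolynomial (Fin 2) k, ∀ q' : AffinePoint p K,
        u q' * aeval ![q'.1.1, q'.1.2] D = aeval ![q'.1.1, q'.1.2] N}
      zero_mem' := ⟨0, fun q' => by simp⟩
      add_mem' := by
        rintro D D' ⟨N, hN⟩ ⟨N', hN'⟩
        exact ⟨N + N', fun q' => by rw [map_add, map_add, mul_add, hN, hN']⟩
      smul_mem' := by
        rintro c D ⟨N, hN⟩
        exact ⟨c * N, fun q' => by rw [smul_eq_mul, map_mul, map_mul, ← hN]; ring⟩ }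
  have hp : (X 1 ^ 2 - Polynomial.aeval (X 0) p : MvPolynomial (Fin 2) k) ∈ I := by
    refine ⟨0, fun q' => ?_⟩
    rw [map_zero, map_sub, map_pow, MvPolynomial.aeval_X, ← Polynomial.aeval_algHom_apply,
      MvPolynomial.aeval_X]
    simp [q'.2]
  have hI : I = ⊤ := by
    have h0 : zeroLocus K I = ∅ := by
      ext v
      simp only [mem_zeroLocus_iff, Set.mem_empty_iff_false, iff_false]
      intro hv
      have h1 := hv _ hp
      rw [map_sub, map_pow, MvPolynomial.aeval_X, ← Polynomial.aeval_algHom_apply,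
        MvPolynomial.aeval_X, sub_eq_zero] at h1
      obtain ⟨N, D, hD, hN⟩ := hu ⟨(v 0, v 1), h1⟩
      refine hD ?_
      rw [show ![v 0, v 1] = v by ext i; fin_cases i <;> rfl]
      exact hv D ⟨N, hN⟩
    have h1 := vanishingIdeal_zeroLocus_eq_radical (K := K) I
    rw [h0, vanishingIdeal_empty] at h1
    exact Ideal.radical_eq_top.1 h1.symm
  obtain ⟨N, hN⟩ : (1 : MvPolynomial (Fin 2) k) ∈ I := hI ▸ Submodule.mem_top
  refine ⟨aeval ![⟨Polynomial.X, 0⟩, ⟨0, 1⟩] N, ?_⟩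
  ext q
  have h1 := hN q
  rw [map_one, mul_one] at h1
  rw [h1]
  change ((Pi.evalAlgHom k (fun _ => K) q).comp (evalHom p K)) _ = _
  rw [← AlgHom.comp_apply, comp_aeval]
  congr 2
  ext i
  fin_cases i <;> simp [evalHom_apply]

variable {p r : k[X]}

theorem exists_pullback (c : AffinePoint p K → AffinePoint r K) {z z' : QuadraticAlgebra k[X] p 0}
    (hz : ∀ q, (c q).1 = (evalHom p K z q, evalHom p K z' q)) (g : QuadraticAlgebra k[X] r 0) :
    ∃ g', ∀ q, evalHom p K g' q = evalHom r K g (c q) := by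
  refine ⟨Polynomial.aeval z g.re + Polynomial.aeval z g.im * z', fun q => ?_⟩
  rw [evalHom_apply g, hz, aeval_comp_evalHom, aeval_comp_evalHom, map_add, map_mul]
  rfl

/-- A biregular map between the affine curves `w² = p` and `w² = r` is affine in `t` and scales
`w`. -/
theorem exists_linear_of_affinePoint_equiv [IsAlgClosed K] (h2 : (2 : k) ≠ 0)
    (hdeg : 3 ≤ p.natDegree)
    (hsq : ¬ IsSquare p) (c : AffinePoint p K ≃ AffinePoint r K)
    {z z' : QuadraticAlgebra k[X] p 0} (hz : ∀ q, (c q).1 = (evalHom p K z q, evalHom p K z' q))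
    {y y' : QuadraticAlgebra k[X] r 0}
    (hy : ∀ q, (c.symm q).1 = (evalHom r K y q, evalHom r K y' q)) :
    ∃ α β e : k, α ≠ 0 ∧ e ≠ 0 ∧ ∀ q, (c q).1 =
      (algebraMap k K α * q.1.1 + algebraMap k K β, algebraMap k K e * q.1.2) := by
  have hp : p ≠ 0 := by rintro rfl; simp at hdeg
  have hr : r ≠ 0 := by
    rintro rfl
    -- functions on the points of `w² = 0` are polynomials in `t`
    refine not_surjective_of_polynomial h2 hdeg hsq (Polynomial.aeval z) fun g => ?_
    obtain ⟨g', hg'⟩ := exists_pullback c.symm hy g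
    refine ⟨g'.re, evalHom_injective (K := K) h2 hp ?_⟩
    ext q
    have h1 := hg' (c q)
    have h3 : (c q).1.2 = 0 := by simpa using (c q).2
    rw [c.symm_apply_apply, evalHom_apply, h3, mul_zero, add_zero, hz] at h1
    rw [← h1, aeval_comp_evalHom]
  choose θ hθ using exists_pullback c hz
  choose η hη using exists_pullback c.symm hy
  have hinj := evalHom_injective (K := K) h2 hp
  have hinj' := evalHom_injective (K := K) h2 hr
  let Θ : QuadraticAlgebra k[X] r 0 ≃ₐ[k] QuadraticAlgebra k[X] p 0 :=
    { toFun := θ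
      invFun := η
      left_inv := fun g => hinj' (by ext q; rw [hη, hθ, c.apply_symm_apply])
      right_inv := fun g => hinj (by ext q; rw [hθ, hη, c.symm_apply_apply])
      map_mul' := fun a b => hinj (by
        ext q; rw [hθ, map_mul, map_mul, Pi.mul_apply, Pi.mul_apply, hθ, hθ])
      map_add' := fun a b => hinj (by
        ext q; rw [hθ, map_add, map_add, Pi.add_apply, Pi.add_apply, hθ, hθ])
      commutes' := fun a => hinj (by ext q; rw [hθ, AlgHom.commutes, AlgHom.commutes]; rfl) }
  obtain ⟨α, β, e, hα, he, hX, hω⟩ := exists_linear_of_algEquiv h2 hdeg hsq Θ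
  refine ⟨α, β, e, hα, he, fun q => Prod.ext ?_ ?_⟩
  · have h1 := hθ ⟨Polynomial.X, 0⟩ q
    rw [show θ ⟨Polynomial.X, 0⟩ = _ from hX, evalHom_apply, evalHom_apply] at h1
    simpa using h1.symm
  · have h1 := hθ ⟨0, 1⟩ q
    rw [show θ ⟨0, 1⟩ = _ from hω, evalHom_apply, evalHom_apply] at h1
    simpa using h1.symm

end QuadraticAlgebra

/-! ### The affine part of a quartic curve -/

namespace QuarticCurve

open WeightedPlaneCurve QuadraticAlgebra

open scoped Polynomial

variable {k : Type*} [Field k] {f h : homogeneousSubmodule (Fin 2) k 4}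

/-- The dehomogenization `f(t, 1)`. -/
noncomputable def dehom (f : homogeneousSubmodule (Fin 2) k 4) : k[X] :=
  aeval ![Polynomial.X, 1] f.1

theorem aeval_dehom {K : Type*} [Field K] [Algebra k K] (t : K) :
    Polynomial.aeval t (dehom f) = aeval ![t, 1] f.1 := by
  rw [dehom, ← AlgHom.comp_apply, comp_aeval]
  congr 2
  ext i
  fin_cases i <;> simp

/-- The coordinate vector `(t, 1, w)` of an affine point `(t, w)`. -/
noncomputable def toCone (q : AffinePoint (dehom f) (AlgebraicClosure k)) :
    (quarticCurve f).Cone (AlgebraicClosure k) :=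
  coneMk f q.1.1 1 q.1.2 (Or.inr one_ne_zero) (by rw [q.2, aeval_dehom])

theorem toCone_val (q : AffinePoint (dehom f) (AlgebraicClosure k)) :
    (toCone q).1 = ![q.1.1, 1, q.1.2] := rfl

theorem exists_toCone {Q : (quarticCurve f).Cone (AlgebraicClosure k)} (hQ : Q.1 1 ≠ 0) :
    ∃ q, Point.mk (toCone q) = Point.mk Q := by
  have hq : (Q.1 2 / Q.1 1 ^ 2) ^ 2 = Polynomial.aeval (Q.1 0 / Q.1 1) (dehom f) := by
    have h1 := form_smul (f := f) (Q.1 1)⁻¹ (Q.1 0) (Q.1 1)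
    rw [← cone_sq, inv_mul_cancel₀ hQ] at h1
    rw [aeval_dehom, div_eq_inv_mul (Q.1 0), h1]
    field_simp
  refine ⟨⟨(Q.1 0 / Q.1 1, Q.1 2 / Q.1 1 ^ 2), hq⟩, mk_eq_mk.2 ⟨Q.1 1, hQ, ?_, ?_, ?_⟩⟩
  all_goals
    simp only [toCone_val, Matrix.cons_val_zero, Matrix.cons_val_one, Matrix.cons_val]
    field_simp

theorem toCone_injective {q q' : AffinePoint (dehom f) (AlgebraicClosure k)}
    (H : Point.mk (toCone q) = Point.mk (toCone q')) : q = q' := by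
  obtain ⟨t, -, h0, h1, h2⟩ := mk_eq_mk.1 H
  simp only [toCone_val, Matrix.cons_val_zero, Matrix.cons_val_one, Matrix.cons_val] at h0 h1 h2
  rw [mul_one] at h1
  rw [← h1, one_mul] at h0
  rw [← h1, one_pow, one_mul] at h2
  exact Subtype.ext (Prod.ext h0.symm h2.symm)

/-- The points of `w² = f(x, y)` on the line `y = 0`. -/
def AtInfinity (P : (quarticCurve f).Point) : Prop := ∃ Q, Point.mk Q = P ∧ Q.1 1 = 0

theorem atInfinity_mk {Q : (quarticCurve f).Cone (AlgebraicClosure k)} :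
    AtInfinity (Point.mk Q) ↔ Q.1 1 = 0 := by
  refine ⟨fun ⟨R, hR, h0⟩ => ?_, fun h => ⟨Q, rfl, h⟩⟩
  obtain ⟨t, -, -, h1, -⟩ := mk_eq_mk.1 hR
  rw [h1, h0, mul_zero]

/-- A morphism between quartic curves preserving the affine part is there given by elements of the
coordinate ring. -/
theorem exists_affine_map {χ : (quarticCurve h).Point → (quarticCurve f).Point}
    (hχ : IsMorphism χ) (hinf : ∀ P, ¬ AtInfinity P → ¬ AtInfinity (χ P)) :
    ∃ (c : AffinePoint (dehom h) (AlgebraicClosure k) → AffinePoint (dehom f) (AlgebraicClosure k))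
      (z z' : QuadraticAlgebra k[X] (dehom h) 0),
      (∀ q, (c q).1 = (evalHom _ _ z q, evalHom _ _ z' q)) ∧
      ∀ q, χ (Point.mk (toCone q)) = Point.mk (toCone (c q)) := by
  have hc : ∀ q : AffinePoint (dehom h) (AlgebraicClosure k), ∃ q',
      χ (Point.mk (toCone q)) = Point.mk (toCone q') := fun q => by
    obtain ⟨R, hR⟩ := (χ (Point.mk (toCone q))).exists_rep
    have h1 := hinf (Point.mk (toCone q)) (by
      rw [atInfinity_mk]; simp [toCone_val])
    rw [← hR, atInfinity_mk] at h1
    obtain ⟨q', hq'⟩ := exists_toCone h1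
    exact ⟨q', by rw [hq', hR]⟩
  choose c hc using hc
  have key : ∀ q : AffinePoint (dehom h) (AlgebraicClosure k), ∃ F : Fin 3 → MvPolynomial (Fin 2) k,
      aeval ![q.1.1, q.1.2] (F 1) ≠ 0 ∧ ∀ q' : AffinePoint (dehom h) (AlgebraicClosure k),
        (c q').1.1 * aeval ![q'.1.1, q'.1.2] (F 1) = aeval ![q'.1.1, q'.1.2] (F 0) ∧
        (c q').1.2 * aeval ![q'.1.1, q'.1.2] (F 1) ^ 2 = aeval ![q'.1.1, q'.1.2] (F 2) := by
    intro q
    obtain ⟨n, F, -, h0, hF⟩ := hχ (toCone q)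
    have hev : ∀ (q' : AffinePoint (dehom h) (AlgebraicClosure k)) (G : MvPolynomial (Fin 3) k),
        aeval ![q'.1.1, q'.1.2] (bind₁ ![X 0, 1, X 1] G) = aeval (toCone q').1 G := by
      intro q' G
      rw [aeval_bind₁]
      congr 2
      ext i
      fin_cases i <;> simp [toCone_val]
    have hscale : ∀ q' : AffinePoint (dehom h) (AlgebraicClosure k),
        (∃ i, aeval (toCone q').1 (F i) ≠ 0) → ∃ t : AlgebraicClosure k, t ≠ 0 ∧
          aeval (toCone q').1 (F 0) = t * (c q').1.1 ∧ aeval (toCone q').1 (F 1) = t ∧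
          aeval (toCone q').1 (F 2) = t ^ 2 * (c q').1.2 := by
      intro q' hq'
      obtain ⟨R, hR, hR'⟩ := hF _ hq'
      rw [hc] at hR'
      obtain ⟨t, ht, h1, h2, h3⟩ := mk_eq_mk.1 hR'
      simp only [toCone_val, Matrix.cons_val_zero, Matrix.cons_val_one, Matrix.cons_val] at h1 h2 h3
      rw [hR] at h1 h2 h3
      exact ⟨t, ht, h1, by rw [h2, mul_one], h3⟩
    refine ⟨fun i => bind₁ ![X 0, 1, X 1] (F i), ?_, fun q' => ?_⟩
    · obtain ⟨t, ht, -, h1, -⟩ := hscale q h0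
      rwa [hev, h1]
    · simp only [hev]
      by_cases hq' : ∃ i, aeval (toCone q').1 (F i) ≠ 0
      · obtain ⟨t, -, h1, h2, h3⟩ := hscale q' hq'
        rw [h1, h2, h3]
        exact ⟨mul_comm _ _, mul_comm _ _⟩
      · push Not at hq'
        simp [hq']
  obtain ⟨z, hz⟩ := exists_evalHom_eq (fun q => (c q).1.1) fun q => by
    obtain ⟨F, h1, h2⟩ := key q
    exact ⟨F 0, F 1, h1, fun q' => (h2 q').1⟩
  obtain ⟨z', hz'⟩ := exists_evalHom_eq (fun q => (c q).1.2) fun q => by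
    obtain ⟨F, h1, h2⟩ := key q
    exact ⟨F 2, F 1 ^ 2, by rw [map_pow]; exact pow_ne_zero 2 h1, fun q' => by
      rw [map_pow]; exact (h2 q').2⟩
  exact ⟨c, z, z', fun q => Prod.ext (congrFun hz q).symm (congrFun hz' q).symm, hc⟩

theorem form_eq_of_dehom (H : ∀ t : AlgebraicClosure k, t ≠ 0 → aeval ![t, 1] f.1 =
    aeval ![t, 1] h.1) : f = h := by
  have h1 : X 0 * X 1 * (f - h).1 = 0 := by
    apply map_injective _ (algebraMap k (AlgebraicClosure k)).injective
    refine MvPolynomial.funext fun v => ?_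
    rw [eval_map, eval_map, ← aeval_def, ← aeval_def, map_zero, map_mul, map_mul, aeval_X, aeval_X]
    by_cases h0 : v 0 = 0
    · rw [h0, zero_mul, zero_mul]
    by_cases h1 : v 1 = 0
    · rw [h1, mul_zero, zero_mul]
    have h2 := H (v 0 / v 1) (div_ne_zero h0 h1)
    have h3 := form_smul (f := f - h) (v 1) (v 0 / v 1) 1
    rw [mul_div_cancel₀ _ h1, mul_one, show ![v 0, v 1] = v by ext i; fin_cases i <;> rfl] at h3
    rw [h3, Submodule.coe_sub, map_sub, h2, sub_self, mul_zero, mul_zero]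
  have h2 : (X 0 * X 1 : MvPolynomial (Fin 2) k) ≠ 0 := mul_ne_zero (X_ne_zero _) (X_ne_zero _)
  exact sub_eq_zero.1 (Subtype.ext ((mul_eq_zero.1 h1).resolve_left h2))

/-- A polynomial which vanishes on the affine part of `w² = h(x, y)` vanishes on the whole curve. -/
theorem aeval_eq_zero_of_affine (h2 : (2 : k) ≠ 0) (hh : h ≠ 0) {G : MvPolynomial (Fin 3) k}
    (hG : ∀ Q : (quarticCurve h).Cone (AlgebraicClosure k), Q.1 1 ≠ 0 → aeval Q.1 G = 0)
    (Q : (quarticCurve h).Cone (AlgebraicClosure k)) (h0 : Q.1 0 = 1) (h1 : Q.1 1 = 0) :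
    aeval Q.1 G = 0 := by
  -- work in the affine chart `x = 1`, where the affine part is the complement of `y = 0`
  set p : k[X] := aeval ![1, Polynomial.X] h.1 with hp
  have hpev : ∀ t : AlgebraicClosure k, Polynomial.aeval t p = aeval ![1, t] h.1 := fun t => by
    rw [hp, ← AlgHom.comp_apply, comp_aeval]
    congr 2
    ext i
    fin_cases i <;> simp
  have hp0 : p ≠ 0 := by
    intro h0
    refine hh (form_eq_of_dehom fun t ht => ?_)
    have h3 := form_smul (f := h) t 1 t⁻¹
    rw [mul_one, mul_inv_cancel₀ ht, ← hpev, h0, map_zero, mul_zero] at h3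
    rw [h3]
    simp
  have hev : ∀ q : AffinePoint p (AlgebraicClosure k),
      evalHom p _ (aeval ![1, ⟨Polynomial.X, 0⟩, ⟨0, 1⟩] G) q = aeval ![1, q.1.1, q.1.2] G := by
    intro q
    change ((Pi.evalAlgHom k (fun _ => AlgebraicClosure k) q).comp (evalHom p _)) _ = _
    rw [← AlgHom.comp_apply, comp_aeval]
    congr 2
    ext i
    fin_cases i <;> simp [evalHom_apply]
  have hz : (aeval ![1, ⟨Polynomial.X, 0⟩, ⟨0, 1⟩] G : QuadraticAlgebra k[X] p 0) = 0 := by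
    refine eq_zero_of_evalHom (K := AlgebraicClosure k) h2 hp0 fun q hq => ?_
    rw [hev]
    exact hG (coneMk h 1 q.1.1 q.1.2 (Or.inl one_ne_zero) (by rw [q.2, hpev])) hq
  have h3 := hev ⟨(0, Q.1 2), by
    have := cone_sq Q
    rw [h0, h1] at this
    rw [this, hpev]⟩
  rw [hz, map_zero] at h3
  have h4 : Q.1 = ![1, 0, Q.1 2] := by
    ext i
    fin_cases i
    · exact h0
    · exact h1
    · rfl
  rw [h4]
  exact h3.symm

end QuarticCurve

/-! ### Isomorphisms of quartic curves which respect the line `y = 0` are linear -/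

namespace QuarticCurve

open WeightedPlaneCurve QuadraticAlgebra

open scoped Polynomial

variable {k : Type*} [Field k] {f h : homogeneousSubmodule (Fin 2) k 4}

/-- Two isomorphisms which agree on the affine part of `w² = h(x, y)` agree, if the second one is
linear. -/
theorem eq_of_isLinear_of_affine (h2 : (2 : k) ≠ 0) (hh : h ≠ 0) {g : GL (Fin 2) k} {e : kˣ}
    (hg : g.1 1 0 = 0) {χ ψ : (quarticCurve h).Point ≃ (quarticCurve f).Point}
    (hχ : IsMorphism (χ : (quarticCurve h).Point → (quarticCurve f).Point))
    (hψ : IsLinear g e ψ) (H : ∀ q, χ (Point.mk (toCone q)) = ψ (Point.mk (toCone q))) :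
    χ = ψ := by
  have H' : ∀ Q : (quarticCurve h).Cone (AlgebraicClosure k), Q.1 1 ≠ 0 →
      χ (Point.mk Q) = ψ (Point.mk Q) := fun Q hQ => by
    obtain ⟨q, hq⟩ := exists_toCone hQ
    rw [← hq, H]
  ext P
  obtain ⟨Q, rfl⟩ := P.exists_rep
  by_cases hQ : Q.1 1 = 0
  swap
  · exact H' Q hQ
  -- scale to `Q = (1, 0, w)`
  have hQ0 : Q.1 0 ≠ 0 := (cone_ne_zero Q).resolve_right fun h => h hQ
  obtain ⟨S, hS, hSQ⟩ := exists_mk_eq (v := Q) (u := fun i => (Q.1 0)⁻¹ ^ (quarticCurve h).weight i *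
    Q.1 i) (inv_ne_zero hQ0) (fun _ => rfl)
  have hS0 : S.1 0 = 1 := by rw [hS]; simp [quarticCurve, hQ0]
  have hS1 : S.1 1 = 0 := by rw [hS]; simp [hQ]
  rw [← hSQ]
  obtain ⟨n, F, -, hF0, hF⟩ := hχ S
  obtain ⟨F0, hF0'⟩ : ∃ L : Fin 3 → MvPolynomial (Fin 3) k, ∀ v, (fun i => aeval v (L i)) =
      linVec g.1 (e : k) v := (linVec_homogeneous (e : k) g.1).imp fun _ h => h.2
  have hL : ∀ v i, aeval v (F0 i) = linVec g.1 (e : k) v i := fun v i => congrFun (hF0' v) i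
  -- proportionality of the two maps is a polynomial identity on the affine part
  have hprop : ∀ R : (quarticCurve h).Cone (AlgebraicClosure k), R.1 1 ≠ 0 →
      aeval R.1 (F0 0 * F 1 - F0 1 * F 0) = 0 ∧
      aeval R.1 (F 2 * F0 0 ^ 2 - F0 2 * F 0 ^ 2) = 0 := by
    intro R hR
    simp only [map_sub, map_mul, map_pow]
    by_cases hR0 : ∃ i, aeval R.1 (F i) ≠ 0
    · obtain ⟨T, hT, hT'⟩ := hF R hR0
      obtain ⟨U, hU, hU'⟩ := hψ R
      have h1 := H' R hR
      rw [hT', hU'] at h1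
      obtain ⟨t, -, h3, h4, h5⟩ := mk_eq_mk.1 h1
      rw [← hT, ← hT, ← hT, hL, hL, hL, ← hU, h3, h4, h5]
      constructor <;> ring
    · push Not at hR0
      simp [hR0]
  have h3 := aeval_eq_zero_of_affine h2 hh (fun R hR => (hprop R hR).1) S hS0 hS1
  have h4 := aeval_eq_zero_of_affine h2 hh (fun R hR => (hprop R hR).2) S hS0 hS1
  simp only [map_sub, map_mul, map_pow, hL] at h3 h4
  obtain ⟨T, hT, hT'⟩ := hF S hF0
  obtain ⟨U, hU, hU'⟩ := hψ S
  have hU1 : U.1 1 = 0 := by simp [hU, linVec, hS1, hg]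
  have hU0 : U.1 0 ≠ 0 := (cone_ne_zero U).resolve_right fun h => h hU1
  rw [← hT, ← hT, ← hU, hU1, zero_mul, sub_zero] at h3
  have hT1 : T.1 1 = 0 := (mul_eq_zero.1 h3).resolve_left hU0
  have hT0 : T.1 0 ≠ 0 := (cone_ne_zero T).resolve_right fun h => h hT1
  rw [← hT, ← hT, ← hU] at h4
  rw [hT', hU', mk_eq_mk]
  refine ⟨U.1 0 / T.1 0, div_ne_zero hU0 hT0, ?_, ?_, ?_⟩
  · field_simp
  · rw [hU1, hT1, mul_zero]
  · field_simp
    linear_combination -h4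

theorem exists_affine_linear_of_isIso (h2 : (2 : k) ≠ 0) (hdeg : 3 ≤ (dehom h).natDegree)
    (hsq : ¬ IsSquare (dehom h)) {χ : (quarticCurve h).Point ≃ (quarticCurve f).Point}
    (hχ : IsIso χ) (hinf : ∀ P, AtInfinity (χ P) ↔ AtInfinity P) :
    ∃ α β e : k, α ≠ 0 ∧ e ≠ 0 ∧ ∀ q : AffinePoint (dehom h) (AlgebraicClosure k),
      ∃ q', χ (Point.mk (toCone q)) = Point.mk (toCone q') ∧
        q'.1.1 = algebraMap k _ α * q.1.1 + algebraMap k _ β ∧ q'.1.2 = algebraMap k _ e * q.1.2 := by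
  obtain ⟨c, z, z', hz, hc⟩ := exists_affine_map hχ.1 fun P hP => by rwa [hinf]
  obtain ⟨d, y, y', hy, hd⟩ := exists_affine_map hχ.2 fun P hP => by
    rwa [← hinf, Equiv.apply_symm_apply]
  have hdc : Function.LeftInverse d c := fun q =>
    toCone_injective (by rw [← hd, ← hc, Equiv.symm_apply_apply])
  have hcd : Function.LeftInverse c d := fun q =>
    toCone_injective (by rw [← hc, ← hd, Equiv.apply_symm_apply])
  obtain ⟨α, β, e, hα, he, hlin⟩ := exists_linear_of_affinePoint_equiv h2 hdeg hsq
    (Equiv.mk c d hdc hcd) hz hy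
  exact ⟨α, β, e, hα, he, fun q => ⟨c q, hc q, congrArg Prod.fst (hlin q),
    congrArg Prod.snd (hlin q)⟩⟩

/-- An isomorphism between quartic curves which respects the two lines `y = 0` is linear, if the
source is given by a quartic which is not a square and does not vanish doubly at infinity. -/
theorem exists_isLinear_of_isIso (h2 : (2 : k) ≠ 0) (hdeg : 3 ≤ (dehom h).natDegree)
    (hsq : ¬ IsSquare (dehom h)) {χ : (quarticCurve h).Point ≃ (quarticCurve f).Point}
    (hχ : IsIso χ) (hinf : ∀ P, AtInfinity (χ P) ↔ AtInfinity P) :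
    ∃ g e, IsLinear g e χ := by
  obtain ⟨α, β, e, hα, he, hlin⟩ := exists_affine_linear_of_isIso h2 hdeg hsq hχ hinf
  obtain ⟨g, hg⟩ : ∃ g : GL (Fin 2) k, g.1 = !![α, β; 0, 1] :=
    ⟨Matrix.GeneralLinearGroup.mkOfDetNeZero !![α, β; 0, 1]
      (by simpa [Matrix.det_fin_two] using hα), rfl⟩
  obtain ⟨e, rfl⟩ : ∃ e' : kˣ, (e' : k) = e := ⟨Units.mk0 e he, rfl⟩
  have hform : formSubst g.1 ((e : k) ^ 2)⁻¹ f = h := by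
    refine form_eq_of_dehom fun t _ => ?_
    obtain ⟨w, hw⟩ := exists_sq h t 1
    obtain ⟨q', -, h3, h4⟩ := hlin ⟨(t, w), by rw [aeval_dehom, hw]⟩
    have h5 := q'.2
    dsimp only at h3 h4
    rw [aeval_dehom, h3, h4] at h5
    rw [aeval_formSubst, hg]
    simp only [Matrix.of_apply, Matrix.cons_val_zero, Matrix.cons_val_one,
      map_zero, map_one, zero_mul, zero_add, mul_one]
    have h6 : algebraMap k (AlgebraicClosure k) (e : k) ≠ 0 := by simp
    rw [← h5, ← hw, map_inv₀, map_pow, mul_pow, inv_mul_cancel_left₀ (pow_ne_zero 2 h6)]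
  have hh : h ≠ 0 := by
    rintro rfl
    simp [dehom] at hdeg
  obtain ⟨ψ, hψ⟩ : ∃ ψ : (quarticCurve h).Point ≃ (quarticCurve f).Point, IsLinear g e ψ := by
    rw [← hform]
    exact (exists_isLinear f g e).imp fun _ h => h.2
  refine ⟨g, e, ?_⟩
  rwa [eq_of_isLinear_of_affine h2 hh (by rw [hg]; rfl) hχ.1 hψ fun q => ?_]
  obtain ⟨R, hR, hR'⟩ := hψ (toCone q)
  obtain ⟨q', h3, h4, h5⟩ := hlin q
  rw [h3, hR']
  congr 1
  apply Subtype.ext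
  rw [hR, toCone_val, toCone_val, linVec, hg, h4, h5]
  ext i
  fin_cases i <;> simp

theorem IsLinear.of_refl (hf : f ≠ 0) {g : GL (Fin 2) k} {e : kˣ}
    (hφ : IsLinear g e (Equiv.refl (quarticCurve f).Point)) :
    ∃ t : kˣ, g.1 = (t : k) • (1 : Matrix (Fin 2) (Fin 2) k) ∧ e = t ^ 2 := by
  have key : ∀ Q : (quarticCurve f).Cone (AlgebraicClosure k), ∃ s : AlgebraicClosure k, s ≠ 0 ∧
      algebraMap k _ (g.1 0 0) * Q.1 0 + algebraMap k _ (g.1 0 1) * Q.1 1 = s * Q.1 0 ∧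
      algebraMap k _ (g.1 1 0) * Q.1 0 + algebraMap k _ (g.1 1 1) * Q.1 1 = s * Q.1 1 ∧
      algebraMap k _ (e : k) * Q.1 2 = s ^ 2 * Q.1 2 := fun Q => by
    obtain ⟨R, hR, hR'⟩ := hφ Q
    obtain ⟨s, hs, h0, h1, h2⟩ := mk_eq_mk.1 hR'
    refine ⟨s, hs, ?_, ?_, ?_⟩
    · rw [← h0, hR]; rfl
    · rw [← h1, hR]; rfl
    · rw [← h2, hR]; rfl
  have key' : ∀ x y : AlgebraicClosure k, x ≠ 0 ∨ y ≠ 0 → ∃ s : AlgebraicClosure k, s ≠ 0 ∧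
      algebraMap k _ (g.1 0 0) * x + algebraMap k _ (g.1 0 1) * y = s * x ∧
      algebraMap k _ (g.1 1 0) * x + algebraMap k _ (g.1 1 1) * y = s * y := fun x y h0 => by
    obtain ⟨w, hw⟩ := exists_sq f x y
    obtain ⟨s, hs, h1, h2, -⟩ := key (coneMk f x y w h0 hw)
    exact ⟨s, hs, h1, h2⟩
  have hinj := (algebraMap k (AlgebraicClosure k)).injective
  obtain ⟨s, hs, h1, h2⟩ := key' 1 0 (Or.inl one_ne_zero)
  obtain ⟨s', hs', h3, h4⟩ := key' 0 1 (Or.inr one_ne_zero)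
  obtain ⟨s'', hs'', h5, h6⟩ := key' 1 1 (Or.inr one_ne_zero)
  simp only [mul_one, mul_zero, add_zero, zero_add] at h1 h2 h3 h4 h5 h6
  have h10 : g.1 1 0 = 0 := hinj (h2.trans (map_zero _).symm)
  have h01 : g.1 0 1 = 0 := hinj (h3.trans (map_zero _).symm)
  rw [h3, add_zero] at h5
  rw [h2, zero_add] at h6
  have h11 : g.1 1 1 = g.1 0 0 := hinj (h6.trans h5.symm)
  have h00 : g.1 0 0 ≠ 0 := fun h0 => hs (by rw [← h1, h0, map_zero])
  refine ⟨Units.mk0 _ h00, ?_, ?_⟩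
  · ext i j
    fin_cases i <;> fin_cases j <;> simp [h10, h01, h11]
  · have hf' : ∃ x y : AlgebraicClosure k, (x ≠ 0 ∨ y ≠ 0) ∧ aeval ![x, y] f.1 ≠ 0 := by
      by_contra! H
      refine hf (form_ext fun x y => ?_)
      by_cases h0 : x ≠ 0 ∨ y ≠ 0
      · rw [H x y h0]; simp
      · push Not at h0
        rw [h0.1, h0.2, form_zero, form_zero]
    obtain ⟨x, y, h0, hxy⟩ := hf'
    obtain ⟨w, hw⟩ := exists_sq f x y
    obtain ⟨s, -, h7, h8, h9⟩ := key (coneMk f x y w h0 hw)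
    have hw0 : w ≠ 0 := by
      rintro rfl
      exact hxy (by rw [← hw]; simp)
    simp only [coneMk, Matrix.cons_val_zero, Matrix.cons_val_one, Matrix.cons_val] at h7 h8 h9
    rw [h01, map_zero, zero_mul, add_zero] at h7
    rw [h10, map_zero, zero_mul, zero_add, h11] at h8
    have hs0 : algebraMap k _ (g.1 0 0) = s :=
      h0.elim (fun h => mul_right_cancel₀ h h7) (fun h => mul_right_cancel₀ h h8)
    have h12 := mul_right_cancel₀ hw0 h9
    rw [← hs0, ← map_pow] at h12
    exact Units.ext (by simpa using hinj h12)

/-- A linear map determines its matrix and its scalar up to `(t, t²)`. -/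
theorem IsLinear.exists_smul_eq (hf : f ≠ 0) {g g' : GL (Fin 2) k} {e e' : kˣ}
    {φ : (quarticCurve f).Point ≃ (quarticCurve h).Point}
    (hφ : IsLinear g e φ) (hφ' : IsLinear g' e' φ) :
    ∃ t : kˣ, g'.1 = (t : k) • g.1 ∧ e' = t ^ 2 * e := by
  have h1 := hφ'.trans hφ.symm
  rw [Equiv.self_trans_symm] at h1
  obtain ⟨t, ht, ht'⟩ := IsLinear.of_refl hf h1
  refine ⟨t, ?_, ?_⟩
  · have : g'.1 = g.1 * (g⁻¹ * g' : GL (Fin 2) k).1 := by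
      rw [← Units.val_mul, mul_inv_cancel_left]
    rw [this, ht, Matrix.mul_smul, mul_one]
  · rw [← ht', mul_comm, mul_inv_cancel_left]

/-- The pairs `(g, e)` and `(t g, t² e)` induce the same map. -/
theorem IsLinear.smul {g g' : GL (Fin 2) k} {e e' : kˣ}
    {φ : (quarticCurve f).Point ≃ (quarticCurve h).Point}
    (hφ : IsLinear g e φ) {t : kˣ} (hg : g'.1 = (t : k) • g.1) (he : e' = t ^ 2 * e) :
    IsLinear g' e' φ := by
  intro Q
  obtain ⟨R, hR, hR'⟩ := hφ Q
  have ht : algebraMap k (AlgebraicClosure k) t ≠ 0 := by simp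
  obtain ⟨S, hS, hS'⟩ := exists_mk_eq (v := R) (u := linVec g'.1 (e' : k) Q.1) ht fun i => by
    rw [hR, hg, he]
    fin_cases i <;> simp [linVec, quarticCurve] <;> ring
  exact ⟨S, hS, hR'.trans hS'.symm⟩

end QuarticCurve

/-! ### Charts between Weierstrass cubics and quartic curves -/

/-- A polynomial is weighted homogeneous if it scales accordingly, also under a generic scalar and at
a generic vector. -/
theorem MvPolynomial.IsWeightedHomogeneous.of_aeval {k σ : Type*} [CommRing k] {w : σ → ℕ}
    {F : MvPolynomial σ k} {n : ℕ}
    (H : ∀ (t : MvPolynomial σ (Polynomial k)) (v : σ → MvPolynomial σ (Polynomial k)),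
      aeval (fun i => t ^ w i * v i) F = t ^ n * aeval v F) : F.IsWeightedHomogeneous w n := by
  classical
  have key : ∀ d : σ →₀ ℕ, ∀ G : MvPolynomial σ k,
      coeff d (aeval (fun i => C (Polynomial.X : Polynomial k) ^ w i * X i) G) =
        Polynomial.C (coeff d G) * Polynomial.X ^ Finsupp.weight w d := by
    intro d G
    induction G using MvPolynomial.induction_on' with
    | monomial u a =>
      have h1 : aeval (fun i => C (Polynomial.X : Polynomial k) ^ w i * X i) (monomial u a) =
          monomial u (Polynomial.C a * Polynomial.X ^ Finsupp.weight w u) := by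
        rw [aeval_monomial, Finsupp.prod, monomial_eq, map_mul, map_pow, mul_assoc]
        congr 1
        simp_rw [mul_pow, Finset.prod_mul_distrib, ← pow_mul, Finset.prod_pow_eq_pow_sum]
        rw [Finsupp.prod, Finsupp.weight_apply, Finsupp.sum]
        congr 2
        exact Finset.sum_congr rfl fun i _ => mul_comm _ _
      rw [h1, coeff_monomial, coeff_monomial]
      split_ifs with h
      · rw [h]
      · simp
    | add p q hp hq => rw [map_add, coeff_add, hp, hq, coeff_add, map_add, add_mul]
  intro d hd
  have h1 := congrArg (coeff d) (H (C Polynomial.X) X)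
  have h2 : (aeval (X : σ → MvPolynomial σ (Polynomial k)) : _ →ₐ[k] _) =
      mapAlgHom (Algebra.ofId k (Polynomial k)) := algHom_ext fun i => by simp
  have h3 : aeval (X : σ → MvPolynomial σ (Polynomial k)) F = map Polynomial.C F :=
    (DFunLike.congr_fun h2 F).trans rfl
  rw [key, h3, ← map_pow, coeff_C_mul, coeff_map, mul_comm] at h1
  by_contra hne
  have h4 := congrArg (fun p => Polynomial.coeff p (Finsupp.weight w d)) h1
  simp only [Polynomial.coeff_mul_C, Polynomial.coeff_X_pow] at h4
  simp [hne, hd] at h4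

namespace WeierstrassChart

variable {R : Type*} [CommRing R]

/-- The homogeneous Weierstrass polynomial. -/
def cubic (a₁ a₂ a₃ a₄ a₆ : R) (v : Fin 3 → R) : R :=
  v 1 ^ 2 * v 2 + a₁ * v 0 * v 1 * v 2 + a₃ * v 1 * v 2 ^ 2 -
    (v 0 ^ 3 + a₂ * v 0 ^ 2 * v 2 + a₄ * v 0 * v 2 ^ 2 + a₆ * v 2 ^ 3)

section Vertical

variable (a₁ a₂ a₃ a₄ a₆ : R)

/-- The discriminant of the Weierstrass equation as a quadratic equation for the second coordinate.
It describes the double cover of the line given by the vertical lines. -/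
def quarticO (x y : R) : R :=
  (a₁ * x * y + a₃ * y ^ 2) ^ 2 + 4 * y * (x ^ 3 + a₂ * x ^ 2 * y + a₄ * x * y ^ 2 + a₆ * y ^ 3)

/-- Two charts of the map from `w² = quarticO x y` to the Weierstrass cubic. -/
def toCubicO : Fin 2 → (Fin 3 → R) → Fin 3 → R
  | 0, v => ![2 * v 0 * v 1, v 2 - (a₁ * v 0 * v 1 + a₃ * v 1 ^ 2), 2 * v 1 ^ 2]
  | 1, v => ![v 0 * (v 2 + (a₁ * v 0 * v 1 + a₃ * v 1 ^ 2)),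
      2 * (v 0 ^ 3 + a₂ * v 0 ^ 2 * v 1 + a₄ * v 0 * v 1 ^ 2 + a₆ * v 1 ^ 3),
      v 1 * (v 2 + (a₁ * v 0 * v 1 + a₃ * v 1 ^ 2))]

/-- A quadratic form `M` for which the Weierstrass equation reads `Z M = X³`. -/
def quadO (v : Fin 3 → R) : R := v 1 ^ 2 + a₁ * v 0 * v 1 + a₃ * v 1 * v 2 - a₂ * v 0 ^ 2 -
  a₄ * v 0 * v 2 - a₆ * v 2 ^ 2

/-- Two charts of the map from the Weierstrass cubic to `w² = quarticO x y`. -/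
def ofCubicO : Fin 2 → (Fin 3 → R) → Fin 3 → R
  | 0, v => ![v 0, v 2, 2 * v 1 * v 2 + a₁ * v 0 * v 2 + a₃ * v 2 ^ 2]
  | 1, v => ![quadO a₁ a₂ a₃ a₄ a₆ v, v 0 ^ 2, 2 * v 0 * v 1 * quadO a₁ a₂ a₃ a₄ a₆ v +
      a₁ * v 0 ^ 2 * quadO a₁ a₂ a₃ a₄ a₆ v + a₃ * v 0 ^ 4]

variable {a₁ a₂ a₃ a₄ a₆}

theorem cubic_toCubicO {v : Fin 3 → R} (hv : v 2 ^ 2 = quarticO a₁ a₂ a₃ a₄ a₆ (v 0) (v 1))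
    (j : Fin 2) : cubic a₁ a₂ a₃ a₄ a₆ (toCubicO a₁ a₂ a₃ a₄ a₆ j v) = 0 := by
  simp only [quarticO] at hv
  fin_cases j
  · simp [toCubicO, cubic]
    linear_combination 2 * v 1 ^ 2 * hv
  · simp [toCubicO, cubic]
    linear_combination (-(v 0 ^ 3 + a₂ * v 0 ^ 2 * v 1 + a₄ * v 0 * v 1 ^ 2 + a₆ * v 1 ^ 3) *
      (v 2 + (a₁ * v 0 * v 1 + a₃ * v 1 ^ 2))) * hv

theorem sq_ofCubicO {v : Fin 3 → R} (hv : cubic a₁ a₂ a₃ a₄ a₆ v = 0) (j : Fin 2) :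
    ofCubicO a₁ a₂ a₃ a₄ a₆ j v 2 ^ 2 = quarticO a₁ a₂ a₃ a₄ a₆ (ofCubicO a₁ a₂ a₃ a₄ a₆ j v 0)
      (ofCubicO a₁ a₂ a₃ a₄ a₆ j v 1) := by
  simp only [cubic] at hv
  fin_cases j
  · simp [ofCubicO, quarticO]
    linear_combination 4 * v 2 * hv
  · simp [ofCubicO, quarticO]
    linear_combination (norm := (simp only [quadO]; ring1)) (4 * v 0 ^ 2 * (a₄ *
      quadO a₁ a₂ a₃ a₄ a₆ v * v 0 + a₆ * (v 0 ^ 3 + quadO a₁ a₂ a₃ a₄ a₆ v * v 2) -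
      a₃ * v 1 * quadO a₁ a₂ a₃ a₄ a₆ v)) * hv

theorem ofCubicO_toCubicO {v : Fin 3 → R} (hv : v 2 ^ 2 = quarticO a₁ a₂ a₃ a₄ a₆ (v 0) (v 1))
    (j l : Fin 2) : ∃ t : R, ∀ i, ofCubicO a₁ a₂ a₃ a₄ a₆ l (toCubicO a₁ a₂ a₃ a₄ a₆ j v) i =
      t ^ (![1, 1, 2] : Fin 3 → ℕ) i * v i := by
  simp only [quarticO] at hv
  fin_cases j <;> fin_cases l
  · refine ⟨2 * v 1, fun i => ?_⟩
    fin_cases i <;> simp [ofCubicO, toCubicO] <;> ring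
  · refine ⟨4 * v 0 ^ 2 * v 1, fun i => ?_⟩
    fin_cases i <;> simp [ofCubicO, toCubicO, quadO]
    · linear_combination hv
    · ring
    · linear_combination (4 * v 0 * v 1 * (v 2 - (a₁ * v 0 * v 1 + a₃ * v 1 ^ 2)) +
        4 * a₁ * v 0 ^ 2 * v 1 ^ 2) * hv
  · refine ⟨v 2 + (a₁ * v 0 * v 1 + a₃ * v 1 ^ 2), fun i => ?_⟩
    fin_cases i <;> simp [ofCubicO, toCubicO]
    · ring
    · ring
    · linear_combination -(v 2 + (a₁ * v 0 * v 1 + a₃ * v 1 ^ 2)) * hv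
  · obtain ⟨q, hq⟩ : ∃ q, q = a₁ * v 0 + a₃ * v 1 := ⟨_, rfl⟩
    obtain ⟨d, hd⟩ : ∃ d, d = a₂ * v 0 ^ 2 + a₄ * v 0 * v 1 + a₆ * v 1 ^ 2 := ⟨_, rfl⟩
    obtain ⟨c, hc⟩ : ∃ c, c = v 0 ^ 3 + v 1 * d := ⟨_, rfl⟩
    obtain ⟨u, hu⟩ : ∃ u, u = v 2 + v 1 * q := ⟨_, rfl⟩
    obtain ⟨t, ht⟩ : ∃ t, t = 2 * v 0 ^ 2 * (u * q + 2 * c) := ⟨_, rfl⟩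
    refine ⟨t, fun i => ?_⟩
    fin_cases i <;> simp [ofCubicO, toCubicO, quadO]
    · subst ht hu hc hd hq
      linear_combination (-(a₂ * v 0 ^ 2 + a₄ * v 0 * v 1 + a₆ * v 1 ^ 2)) * hv
    · subst ht hu hc hd hq
      linear_combination v 0 ^ 2 * hv
    · linear_combination (norm := (subst ht hu hc hd hq; ring1))
        (-(4 * v 0 * u * c + a₁ * v 0 ^ 2 * u ^ 2) * d + a₁ * t * v 0 ^ 3
          + a₃ * v 0 ^ 2 * (v 0 ^ 2 * u ^ 2 + t * v 1) - 2 * t * v 0 ^ 2 * q) * hv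

theorem toCubicO_ofCubicO {v : Fin 3 → R} (hv : cubic a₁ a₂ a₃ a₄ a₆ v = 0)
    (j l : Fin 2) : ∃ t : R, ∀ i, toCubicO a₁ a₂ a₃ a₄ a₆ l (ofCubicO a₁ a₂ a₃ a₄ a₆ j v) i =
      t ^ 1 * v i := by
  simp only [cubic] at hv
  fin_cases j <;> fin_cases l
  · refine ⟨2 * v 2, fun i => ?_⟩
    fin_cases i <;> simp [ofCubicO, toCubicO] <;> ring
  · refine ⟨2 * v 2 * (v 1 + a₁ * v 0 + a₃ * v 2), fun i => ?_⟩
    fin_cases i <;> simp [ofCubicO, toCubicO]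
    · ring
    · linear_combination -2 * hv
    · ring
  · refine ⟨2 * v 0 * quadO a₁ a₂ a₃ a₄ a₆ v, fun i => ?_⟩
    fin_cases i <;> simp [ofCubicO, toCubicO]
    · ring
    · ring
    · linear_combination (norm := (simp only [quadO]; ring1)) -2 * v 0 * hv
  · refine ⟨2 * quadO a₁ a₂ a₃ a₄ a₆ v ^ 2 * (v 1 + a₁ * v 0 + a₃ * v 2), fun i => ?_⟩
    fin_cases i <;> simp [ofCubicO, toCubicO]
    · linear_combination (norm := (simp only [quadO]; ring1))
        -2 * a₃ * v 0 * quadO a₁ a₂ a₃ a₄ a₆ v * hv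
    · linear_combination (norm := (simp only [quadO]; ring1))
        -2 * (a₄ * quadO a₁ a₂ a₃ a₄ a₆ v * v 0 + a₆ * (v 0 ^ 3 + quadO a₁ a₂ a₃ a₄ a₆ v * v 2)) * hv
    · linear_combination (norm := (simp only [quadO]; ring1))
        -(2 * quadO a₁ a₂ a₃ a₄ a₆ v * (v 1 + a₁ * v 0 + a₃ * v 2) + 2 * a₃ * v 0 ^ 3) * hv

end Vertical

section Pencil

variable (a₁ a₂ a₃ a₄ : R)

/-- The quadratic form `Q` in the equation `Z² L + Z Q = X³` of a Weierstrass cubic through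
`[0 : 0 : 1]`; its arguments are `Y` and `X`. -/
def quadP (x y : R) : R := x ^ 2 + a₁ * x * y - a₂ * y ^ 2

/-- The linear form `L` in the equation `Z² L + Z Q = X³` of a Weierstrass cubic through
`[0 : 0 : 1]`; its arguments are `Y` and `X`. -/
def linP (x y : R) : R := a₃ * x - a₄ * y

/-- The discriminant of `Z² L + Z Q = X³` as a quadratic equation for `Z`. It describes the double
cover of the line given by the lines through `[0 : 0 : 1]`. -/
def quarticP (x y : R) : R := quadP a₁ a₂ x y ^ 2 + 4 * y ^ 3 * linP a₃ a₄ x y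

/-- Two charts of the map from `w² = quarticP x y` to the Weierstrass cubic. -/
def toCubicP : Fin 2 → (Fin 3 → R) → Fin 3 → R
  | 0, v => ![2 * v 1 * linP a₃ a₄ (v 0) (v 1), 2 * v 0 * linP a₃ a₄ (v 0) (v 1),
      v 2 - quadP a₁ a₂ (v 0) (v 1)]
  | 1, v => ![v 1 * (v 2 + quadP a₁ a₂ (v 0) (v 1)), v 0 * (v 2 + quadP a₁ a₂ (v 0) (v 1)),
      2 * v 1 ^ 3]

/-- Together with `formB`, a form `A` for which the Weierstrass equation reads `Y B = X A`. -/
def formA (v : Fin 3 → R) : R := v 0 ^ 2 + a₂ * v 0 * v 2 + a₄ * v 2 ^ 2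

/-- Together with `formA`, a form `B` for which the Weierstrass equation reads `Y B = X A`. -/
def formB (v : Fin 3 → R) : R := v 1 * v 2 + a₁ * v 0 * v 2 + a₃ * v 2 ^ 2

/-- The factor `s` in the last coordinate `Q(A, B) + 2 Z s` of the second chart of `ofCubicP`. -/
def formS (v : Fin 3 → R) : R := a₃ * formB a₁ a₃ v * (v 0 + a₂ * v 2) -
  a₄ * v 2 * (formA a₂ a₄ v + a₁ * formB a₁ a₃ v)

/-- Two charts of the map from the Weierstrass cubic to `w² = quarticP x y`. -/
def ofCubicP : Fin 2 → (Fin 3 → R) → Fin 3 → R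
  | 0, v => ![v 1, v 0, 2 * v 2 * linP a₃ a₄ (v 1) (v 0) + quadP a₁ a₂ (v 1) (v 0)]
  | 1, v => ![formA a₂ a₄ v, formB a₁ a₃ v,
      quadP a₁ a₂ (formA a₂ a₄ v) (formB a₁ a₃ v) + 2 * v 2 * formS a₁ a₂ a₃ a₄ v]

variable {a₁ a₂ a₃ a₄}

theorem cubic_toCubicP {v : Fin 3 → R} (hv : v 2 ^ 2 = quarticP a₁ a₂ a₃ a₄ (v 0) (v 1))
    (j : Fin 2) : cubic a₁ a₂ a₃ a₄ 0 (toCubicP a₁ a₂ a₃ a₄ j v) = 0 := by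
  simp only [quarticP] at hv
  fin_cases j
  · simp [toCubicP, cubic]
    linear_combination (norm := (simp only [linP, quadP]; ring1))
      2 * linP a₃ a₄ (v 0) (v 1) ^ 2 * hv
  · simp [toCubicP, cubic]
    linear_combination (norm := (simp only [linP, quadP]; ring1))
      (-v 1 ^ 3 * (v 2 + quadP a₁ a₂ (v 0) (v 1))) * hv

theorem sq_ofCubicP {v : Fin 3 → R} (hv : cubic a₁ a₂ a₃ a₄ 0 v = 0) (j : Fin 2) :
    ofCubicP a₁ a₂ a₃ a₄ j v 2 ^ 2 = quarticP a₁ a₂ a₃ a₄ (ofCubicP a₁ a₂ a₃ a₄ j v 0)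
      (ofCubicP a₁ a₂ a₃ a₄ j v 1) := by
  simp only [cubic] at hv
  fin_cases j
  · simp [ofCubicP, quarticP]
    linear_combination (norm := (simp only [linP, quadP]; ring1))
      4 * linP a₃ a₄ (v 1) (v 0) * hv
  · simp [ofCubicP, quarticP]
    linear_combination (norm := (simp only [linP, quadP, formS, formA, formB]; ring1))
      (4 * v 2 * (a₄ * v 2 * formB a₁ a₃ v * (v 1 + a₁ * v 0 + a₃ * v 2) -
        formS a₁ a₂ a₃ a₄ v * (v 0 + a₂ * v 2))) * hv

theorem ofCubicP_toCubicP {v : Fin 3 → R} (hv : v 2 ^ 2 = quarticP a₁ a₂ a₃ a₄ (v 0) (v 1))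
    (j l : Fin 2) : ∃ t : R, ∀ i, ofCubicP a₁ a₂ a₃ a₄ l (toCubicP a₁ a₂ a₃ a₄ j v) i =
      t ^ (![1, 1, 2] : Fin 3 → ℕ) i * v i := by
  simp only [quarticP] at hv
  fin_cases j <;> fin_cases l
  · refine ⟨2 * linP a₃ a₄ (v 0) (v 1), fun i => ?_⟩
    fin_cases i <;> simp [ofCubicP, toCubicP, linP, quadP] <;> ring
  · obtain ⟨u, hu⟩ : ∃ u, u = v 2 - quadP a₁ a₂ (v 0) (v 1) := ⟨_, rfl⟩
    obtain ⟨t, ht⟩ : ∃ t, t = 4 * a₃ * v 1 ^ 2 * linP a₃ a₄ (v 0) (v 1) +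
      2 * u * (a₂ * a₃ * v 1 - a₄ * v 0 - a₁ * a₄ * v 1) := ⟨_, rfl⟩
    obtain ⟨B, hB⟩ : ∃ B, B = formB a₁ a₃ (toCubicP a₁ a₂ a₃ a₄ 0 v) := ⟨_, rfl⟩
    obtain ⟨A, hA⟩ : ∃ A, A = formA a₂ a₄ (toCubicP a₁ a₂ a₃ a₄ 0 v) := ⟨_, rfl⟩
    have hAt : A - t * v 0 = a₄ * (v 2 ^ 2 - (quadP a₁ a₂ (v 0) (v 1) ^ 2 +
        4 * v 1 ^ 3 * linP a₃ a₄ (v 0) (v 1))) := by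
      subst hA ht hu
      simp [formA, toCubicP, linP, quadP]
      ring
    have hBt : B - t * v 1 = a₃ * (v 2 ^ 2 - (quadP a₁ a₂ (v 0) (v 1) ^ 2 +
        4 * v 1 ^ 3 * linP a₃ a₄ (v 0) (v 1))) := by
      subst hB ht hu
      simp [formB, toCubicP, linP, quadP]
      ring
    rw [hv, sub_self, mul_zero] at hAt hBt
    refine ⟨t, fun i => ?_⟩
    fin_cases i
    · simp [ofCubicP, ← hA]
      linear_combination hAt
    · simp [ofCubicP, ← hB]
      linear_combination hBt
    · simp [ofCubicP, formS, ← hB, ← hA]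
      rw [sub_eq_zero.1 hAt, sub_eq_zero.1 hBt]
      simp only [toCubicP, quadP, linP, Matrix.cons_val_zero,
        Matrix.cons_val] at hu ht ⊢
      subst ht hu
      ring
  · refine ⟨v 2 + quadP a₁ a₂ (v 0) (v 1), fun i => ?_⟩
    fin_cases i <;> simp [ofCubicP, toCubicP]
    · ring
    · ring
    · linear_combination (norm := (simp only [linP, quadP]; ring1))
        -(v 2 + quadP a₁ a₂ (v 0) (v 1)) * hv
  · obtain ⟨u, hu⟩ : ∃ u, u = v 2 + quadP a₁ a₂ (v 0) (v 1) := ⟨_, rfl⟩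
    obtain ⟨t, ht⟩ : ∃ t, t = 2 * v 1 ^ 2 * (2 * a₃ * v 1 ^ 3 + (v 0 + a₁ * v 1) * u) := ⟨_, rfl⟩
    obtain ⟨B, hB⟩ : ∃ B, B = formB a₁ a₃ (toCubicP a₁ a₂ a₃ a₄ 1 v) := ⟨_, rfl⟩
    obtain ⟨A, hA⟩ : ∃ A, A = formA a₂ a₄ (toCubicP a₁ a₂ a₃ a₄ 1 v) := ⟨_, rfl⟩
    have hAt : A - t * v 0 = v 1 ^ 2 * (v 2 ^ 2 - (quadP a₁ a₂ (v 0) (v 1) ^ 2 +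
        4 * v 1 ^ 3 * linP a₃ a₄ (v 0) (v 1))) := by
      subst hA ht hu
      simp [formA, toCubicP, linP, quadP]
      ring
    have hBt : B = t * v 1 := by
      subst hB ht hu
      simp [formB, toCubicP, quadP]
      ring
    rw [hv, sub_self, mul_zero] at hAt
    refine ⟨t, fun i => ?_⟩
    fin_cases i
    · simp [ofCubicP, ← hA]
      linear_combination hAt
    · simp [ofCubicP, ← hB]
      linear_combination hBt
    · simp [ofCubicP, formS, ← hB, ← hA]
      rw [sub_eq_zero.1 hAt, hBt]
      simp only [toCubicP, quadP, linP, Matrix.cons_val_zero,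
        Matrix.cons_val] at hu ht hv ⊢
      linear_combination (norm := (subst ht hu; ring1)) -2 * t * v 1 ^ 2 * (v 0 + a₁ * v 1) * hv

theorem toCubicP_ofCubicP {v : Fin 3 → R} (hv : cubic a₁ a₂ a₃ a₄ 0 v = 0)
    (j l : Fin 2) : ∃ t : R, ∀ i, toCubicP a₁ a₂ a₃ a₄ l (ofCubicP a₁ a₂ a₃ a₄ j v) i =
      t ^ 1 * v i := by
  simp only [cubic] at hv
  fin_cases j <;> fin_cases l
  · refine ⟨2 * linP a₃ a₄ (v 1) (v 0), fun i => ?_⟩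
    fin_cases i <;> simp [ofCubicP, toCubicP] <;> ring
  · refine ⟨2 * (v 2 * linP a₃ a₄ (v 1) (v 0) + quadP a₁ a₂ (v 1) (v 0)), fun i => ?_⟩
    fin_cases i <;> simp [ofCubicP, toCubicP]
    · ring
    · ring
    · linear_combination (norm := (simp only [linP, quadP]; ring1)) -2 * hv
  · refine ⟨2 * formS a₁ a₂ a₃ a₄ v, fun i => ?_⟩
    fin_cases i <;> simp [ofCubicP, toCubicP]
    · linear_combination (norm := (simp only [linP, formS, formA, formB]; ring1))
        -2 * a₄ * v 2 * hv
    · linear_combination (norm := (simp only [linP, formS, formA, formB]; ring1))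
        (-2 * a₃ * (v 0 + a₂ * v 2) + 2 * a₁ * a₄ * v 2) * hv
    · ring
  · refine ⟨2 * formB a₁ a₃ v ^ 2 * (v 1 + a₁ * v 0 + a₃ * v 2), fun i => ?_⟩
    fin_cases i <;> simp [ofCubicP, toCubicP]
    · linear_combination (norm := (simp only [quadP, formS, formA, formB]; ring1))
        -2 * formB a₁ a₃ v * (v 0 + a₂ * v 2) * hv
    · linear_combination (norm := (simp only [quadP, formS, formA, formB]; ring1))
        -2 * (formB a₁ a₃ v * (v 1 + a₁ * v 0 + a₃ * v 2) + formA a₂ a₄ v * (v 0 + a₂ * v 2)) * hv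
    · simp only [formB]
      ring

end Pencil

end WeierstrassChart

/-! ### The isomorphisms defined by the charts -/

namespace WeierstrassChart

open WeightedPlaneCurve QuarticCurve

variable {k : Type*} [Field k]

theorem aeval_weierstrass (E : WeierstrassCurve k) {K : Type*} [Field K] [Algebra k K]
    (v : Fin 3 → K) : aeval v (weierstrassCurve E).poly = cubic (algebraMap k K E.a₁)
      (algebraMap k K E.a₂) (algebraMap k K E.a₃) (algebraMap k K E.a₄) (algebraMap k K E.a₆) v := by
  simp [weierstrassCurve, WeierstrassCurve.Projective.polynomial, cubic]

/-- The binary quartic form `quarticO` with the coefficients of `E`. -/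
noncomputable def formO (E : WeierstrassCurve k) : homogeneousSubmodule (Fin 2) k 4 :=
  ⟨quarticO (C E.a₁) (C E.a₂) (C E.a₃) (C E.a₄) (C E.a₆) (X 0) (X 1),
    IsWeightedHomogeneous.of_aeval fun t v => by simp [quarticO]; ring⟩

theorem aeval_formO (E : WeierstrassCurve k) {R : Type*} [CommRing R] [Algebra k R] (v : Fin 2 → R) :
    aeval v (formO E).1 = quarticO (algebraMap k R E.a₁) (algebraMap k R E.a₂)
      (algebraMap k R E.a₃) (algebraMap k R E.a₄) (algebraMap k R E.a₆) (v 0) (v 1) := by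
  simp [formO, quarticO]

/-- The binary quartic form `quarticP` with the coefficients of `E`; it describes `E` if `a₆ = 0`. -/
noncomputable def formP (E : WeierstrassCurve k) : homogeneousSubmodule (Fin 2) k 4 :=
  ⟨quarticP (C E.a₁) (C E.a₂) (C E.a₃) (C E.a₄) (X 0) (X 1),
    IsWeightedHomogeneous.of_aeval fun t v => by simp [quarticP, quadP, linP]; ring⟩

theorem aeval_formP (E : WeierstrassCurve k) {R : Type*} [CommRing R] [Algebra k R] (v : Fin 2 → R) :
    aeval v (formP E).1 = quarticP (algebraMap k R E.a₁) (algebraMap k R E.a₂)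
      (algebraMap k R E.a₃) (algebraMap k R E.a₄) (v 0) (v 1) := by
  simp [formP, quarticP, quadP, linP]

theorem aeval_toCubicO (E : WeierstrassCurve k) {K : Type*} [Field K] [Algebra k K] (v : Fin 3 → K)
    (j : Fin 2) (i : Fin 3) :
    aeval v (toCubicO (C E.a₁) (C E.a₂) (C E.a₃) (C E.a₄) (C E.a₆) j X i) =
      toCubicO (algebraMap k K E.a₁) (algebraMap k K E.a₂)
      (algebraMap k K E.a₃) (algebraMap k K E.a₄) (algebraMap k K E.a₆) j v i := by
  fin_cases j <;> fin_cases i <;> simp [toCubicO]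

theorem aeval_ofCubicO (E : WeierstrassCurve k) {K : Type*} [Field K] [Algebra k K] (v : Fin 3 → K)
    (j : Fin 2) (i : Fin 3) :
    aeval v (ofCubicO (C E.a₁) (C E.a₂) (C E.a₃) (C E.a₄) (C E.a₆) j X i) =
      ofCubicO (algebraMap k K E.a₁) (algebraMap k K E.a₂)
      (algebraMap k K E.a₃) (algebraMap k K E.a₄) (algebraMap k K E.a₆) j v i := by
  fin_cases j <;> fin_cases i <;> simp [ofCubicO, quadO]

theorem aeval_toCubicP (E : WeierstrassCurve k) {K : Type*} [Field K] [Algebra k K] (v : Fin 3 → K)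
    (j : Fin 2) (i : Fin 3) :
    aeval v (toCubicP (C E.a₁) (C E.a₂) (C E.a₃) (C E.a₄) j X i) =
      toCubicP (algebraMap k K E.a₁) (algebraMap k K E.a₂)
      (algebraMap k K E.a₃) (algebraMap k K E.a₄) j v i := by
  fin_cases j <;> fin_cases i <;> simp [toCubicP, linP, quadP]

theorem aeval_ofCubicP (E : WeierstrassCurve k) {K : Type*} [Field K] [Algebra k K] (v : Fin 3 → K)
    (j : Fin 2) (i : Fin 3) :
    aeval v (ofCubicP (C E.a₁) (C E.a₂) (C E.a₃) (C E.a₄) j X i) =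
      ofCubicP (algebraMap k K E.a₁) (algebraMap k K E.a₂)
      (algebraMap k K E.a₃) (algebraMap k K E.a₄) j v i := by
  fin_cases j <;> fin_cases i <;> simp [ofCubicP, linP, quadP, formA, formB, formS]

theorem cone_formO {E : WeierstrassCurve k}
    (Q : (quarticCurve (formO E)).Cone (AlgebraicClosure k)) :
    Q.1 2 ^ 2 = quarticO (algebraMap k _ E.a₁) (algebraMap k _ E.a₂) (algebraMap k _ E.a₃)
      (algebraMap k _ E.a₄) (algebraMap k _ E.a₆) (Q.1 0) (Q.1 1) := by
  rw [cone_sq, aeval_formO]; rfl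

theorem cone_formP {E : WeierstrassCurve k}
    (Q : (quarticCurve (formP E)).Cone (AlgebraicClosure k)) :
    Q.1 2 ^ 2 = quarticP (algebraMap k _ E.a₁) (algebraMap k _ E.a₂) (algebraMap k _ E.a₃)
      (algebraMap k _ E.a₄) (Q.1 0) (Q.1 1) := by
  rw [cone_sq, aeval_formP]; rfl

theorem cone_cubic {E : WeierstrassCurve k} (Q : (weierstrassCurve E).Cone (AlgebraicClosure k)) :
    cubic (algebraMap k _ E.a₁) (algebraMap k _ E.a₂) (algebraMap k _ E.a₃)
      (algebraMap k _ E.a₄) (algebraMap k _ E.a₆) Q.1 = 0 := by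
  rw [← aeval_weierstrass, Q.2.2]

/-- Completing the square: the charts `toCubicO` glue to an isomorphism. -/
theorem exists_isIso_formO (h2 : (2 : k) ≠ 0) (E : WeierstrassCurve k) :
    ∃ φ : (quarticCurve (formO E)).Point ≃ (weierstrassCurve E).Point, IsIso φ ∧
      ∀ j (Q : (quarticCurve (formO E)).Cone (AlgebraicClosure k)) R,
      (∀ i, R.1 i = toCubicO (algebraMap k _ E.a₁) (algebraMap k _ E.a₂)
      (algebraMap k _ E.a₃) (algebraMap k _ E.a₄) (algebraMap k _ E.a₆) j Q.1 i) →
      φ (Point.mk Q) = Point.mk R := by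
  have h2' : (2 : AlgebraicClosure k) ≠ 0 := by
    have := (map_ne_zero (algebraMap k (AlgebraicClosure k))).2 h2
    rwa [map_ofNat] at this
  obtain ⟨φ, hφ, hφ'⟩ := exists_isIso_of_charts (C := quarticCurve (formO E))
    (D := weierstrassCurve E) (ι := Fin 2) (κ := Fin 2)
    ![2, 3] (fun j i => toCubicO (C E.a₁) (C E.a₂) (C E.a₃) (C E.a₄) (C E.a₆) j X i)
    ![1, 2] (fun j i => ofCubicO (C E.a₁) (C E.a₂) (C E.a₃) (C E.a₄) (C E.a₆) j X i)
    (fun j i => IsWeightedHomogeneous.of_aeval fun t v => by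
      fin_cases j <;> fin_cases i <;> simp [toCubicO, quarticCurve, weierstrassCurve] <;> ring)
    (fun j i => IsWeightedHomogeneous.of_aeval fun t v => by
      fin_cases j <;> fin_cases i <;> simp [ofCubicO, quadO, quarticCurve, weierstrassCurve] <;> ring)
    (fun j Q => by
      simp only [aeval_toCubicO, aeval_weierstrass]
      exact cubic_toCubicO (cone_formO Q) j)
    (fun j Q => by
      simp only [aeval_ofCubicO, aeval_poly, aeval_formO]
      exact sub_eq_zero.2 (sq_ofCubicO (cone_cubic Q) j))
    (fun Q => by
      simp only [aeval_toCubicO]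
      by_cases hy : Q.1 1 = 0
      · have hx := (cone_ne_zero Q).resolve_right fun h => h hy
        exact ⟨1, 1, by simp [toCubicO, hy, hx, h2']⟩
      · exact ⟨0, 2, by simp [toCubicO, hy, h2']⟩)
    (fun Q => by
      simp only [aeval_ofCubicO]
      by_cases hx : Q.1 0 = 0
      · by_cases hz : Q.1 2 = 0
        · have hy : Q.1 1 ≠ 0 := fun hy => Q.2.1 (by ext i; fin_cases i <;> simpa)
          exact ⟨1, 0, by simp [ofCubicO, quadO, hx, hz, hy]⟩
        · exact ⟨0, 1, by simpa [ofCubicO] using hz⟩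
      · exact ⟨0, 0, by simpa [ofCubicO] using hx⟩)
    (fun j l Q => by
      simp only [aeval_toCubicO, aeval_ofCubicO]
      exact ofCubicO_toCubicO (cone_formO Q) j l)
    (fun j l Q => by
      simp only [aeval_toCubicO, aeval_ofCubicO]
      exact toCubicO_ofCubicO (cone_cubic Q) l j)
  refine ⟨φ, hφ, fun j Q R h => hφ' j Q R fun i => ?_⟩
  rw [h, aeval_toCubicO]

/-- Projecting from the point `[0 : 0 : 1]`: the charts `toCubicP` glue to an isomorphism. The point
is nonsingular on the cubic if `a₃` and `a₄` do not both vanish. -/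
theorem exists_isIso_formP (h2 : (2 : k) ≠ 0) (E : WeierstrassCurve k) (h6 : E.a₆ = 0)
    (h34 : E.a₃ ≠ 0 ∨ E.a₄ ≠ 0) :
    ∃ φ : (quarticCurve (formP E)).Point ≃ (weierstrassCurve E).Point, IsIso φ ∧
      ∀ j (Q : (quarticCurve (formP E)).Cone (AlgebraicClosure k)) R,
      (∀ i, R.1 i = toCubicP (algebraMap k _ E.a₁) (algebraMap k _ E.a₂)
      (algebraMap k _ E.a₃) (algebraMap k _ E.a₄) j Q.1 i) →
      φ (Point.mk Q) = Point.mk R := by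
  have h2' : (2 : AlgebraicClosure k) ≠ 0 := by
    have := (map_ne_zero (algebraMap k (AlgebraicClosure k))).2 h2
    rwa [map_ofNat] at this
  have hcubic : ∀ Q : (weierstrassCurve E).Cone (AlgebraicClosure k), cubic (algebraMap k _ E.a₁)
      (algebraMap k _ E.a₂) (algebraMap k _ E.a₃) (algebraMap k _ E.a₄) 0 Q.1 = 0 := fun Q => by
    have := cone_cubic Q
    rwa [h6, map_zero] at this
  obtain ⟨φ, hφ, hφ'⟩ := exists_isIso_of_charts (C := quarticCurve (formP E))
    (D := weierstrassCurve E) (ι := Fin 2) (κ := Fin 2)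
    ![2, 3] (fun j i => toCubicP (C E.a₁) (C E.a₂) (C E.a₃) (C E.a₄) j X i)
    ![1, 2] (fun j i => ofCubicP (C E.a₁) (C E.a₂) (C E.a₃) (C E.a₄) j X i)
    (fun j i => IsWeightedHomogeneous.of_aeval fun t v => by
      fin_cases j <;> fin_cases i <;>
        simp [toCubicP, linP, quadP, quarticCurve, weierstrassCurve] <;> ring)
    (fun j i => IsWeightedHomogeneous.of_aeval fun t v => by
      fin_cases j <;> fin_cases i <;>
        simp [ofCubicP, linP, quadP, formA, formB, formS, quarticCurve, weierstrassCurve] <;> ring)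
    (fun j Q => by
      simp only [aeval_toCubicP, aeval_weierstrass, h6, map_zero]
      exact cubic_toCubicP (cone_formP Q) j)
    (fun j Q => by
      simp only [aeval_ofCubicP, aeval_poly, aeval_formP]
      exact sub_eq_zero.2 (sq_ofCubicP (hcubic Q) j))
    (fun Q => by
      simp only [aeval_toCubicP]
      by_cases hy : Q.1 1 = 0
      · have hx := (cone_ne_zero Q).resolve_right fun h => h hy
        by_cases hw : Q.1 2 = Q.1 0 ^ 2
        · refine ⟨1, 1, ?_⟩
          simp [toCubicP, hy, hx, quadP, hw, ← two_mul, h2']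
        · refine ⟨0, 2, ?_⟩
          simpa [toCubicP, hy, quadP, sub_eq_zero] using hw
      · exact ⟨1, 2, by simp [toCubicP, hy, h2']⟩)
    (fun Q => by
      simp only [aeval_ofCubicP]
      by_cases hx : Q.1 0 = 0
      · by_cases hy : Q.1 1 = 0
        · have hz : Q.1 2 ≠ 0 := fun hz => Q.2.1 (by ext i; fin_cases i <;> simpa)
          rcases h34 with h3 | h4
          · exact ⟨1, 1, by simp [ofCubicP, formB, hx, hz, hy, h3]⟩
          · exact ⟨1, 0, by simp [ofCubicP, formA, hx, hz, h4]⟩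
        · exact ⟨0, 0, by simpa [ofCubicP] using hy⟩
      · exact ⟨0, 1, by simpa [ofCubicP] using hx⟩)
    (fun j l Q => by
      simp only [aeval_toCubicP, aeval_ofCubicP]
      exact ofCubicP_toCubicP (cone_formP Q) j l)
    (fun j l Q => by
      simp only [aeval_toCubicP, aeval_ofCubicP]
      exact toCubicP_ofCubicP (hcubic Q) l j)
  refine ⟨φ, hφ, fun j Q R h => hφ' j Q R fun i => ?_⟩
  rw [h, aeval_toCubicP]

end WeierstrassChart

/-! ### Presentations of an elliptic curve with prescribed points on the line `y = 0` -/

namespace WeierstrassChart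

open WeightedPlaneCurve QuarticCurve

open scoped Polynomial

variable {k : Type*} [Field k]

theorem dehom_formO_natDegree (h2 : (2 : k) ≠ 0) (E : WeierstrassCurve k) :
    (dehom (formO E)).natDegree = 3 := by
  have h4 : (4 : k) ≠ 0 := by
    have := mul_ne_zero h2 h2
    norm_num at this
    exact this
  have : dehom (formO E) = Polynomial.C 4 * Polynomial.X ^ 3 + Polynomial.C E.b₂ * Polynomial.X ^ 2 +
      Polynomial.C (2 * E.b₄) * Polynomial.X + Polynomial.C E.b₆ := by
    rw [dehom, aeval_formO]
    simp only [quarticO, Matrix.cons_val_zero, Matrix.cons_val_one, Polynomial.algebraMap_eq,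
      WeierstrassCurve.b₂, WeierstrassCurve.b₄, WeierstrassCurve.b₆, map_add, map_mul, map_pow,
      map_ofNat]
    ring
  rw [this, Polynomial.natDegree_cubic h4]

theorem dehom_formO_not_isSquare (h2 : (2 : k) ≠ 0) (E : WeierstrassCurve k) :
    ¬ IsSquare (dehom (formO E)) := by
  rintro ⟨q, hq⟩
  have h1 := dehom_formO_natDegree h2 E
  have hq0 : q ≠ 0 := by
    rintro rfl
    rw [hq] at h1
    simp at h1
  rw [hq, Polynomial.natDegree_mul hq0 hq0] at h1
  omega

theorem dehom_formP_eq (E : WeierstrassCurve k) :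
    dehom (formP E) = (Polynomial.X ^ 2 + Polynomial.C E.a₁ * Polynomial.X - Polynomial.C E.a₂) ^ 2 +
      (Polynomial.C (4 * E.a₃) * Polynomial.X - Polynomial.C (4 * E.a₄)) := by
  rw [dehom, aeval_formP]
  simp only [quarticP, quadP, linP, Matrix.cons_val_zero, Matrix.cons_val_one,
    Polynomial.algebraMap_eq, map_mul, map_ofNat]
  ring

theorem dehom_formP_natDegree (E : WeierstrassCurve k) : (dehom (formP E)).natDegree = 4 := by
  rw [dehom_formP_eq]
  compute_degree!

theorem dehom_formP_not_isSquare (h2 : (2 : k) ≠ 0) (E : WeierstrassCurve k)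
    (h34 : E.a₃ ≠ 0 ∨ E.a₄ ≠ 0) : ¬ IsSquare (dehom (formP E)) := by
  have h4 : (4 : k) ≠ 0 := by
    have := mul_ne_zero h2 h2
    norm_num at this
    exact this
  rintro ⟨q, hq⟩
  rw [dehom_formP_eq] at hq
  set p : k[X] := Polynomial.X ^ 2 + Polynomial.C E.a₁ * Polynomial.X - Polynomial.C E.a₂ with hp
  set l : k[X] := Polynomial.C (4 * E.a₃) * Polynomial.X - Polynomial.C (4 * E.a₄) with hl
  have hpdeg : p.natDegree = 2 := by
    rw [hp]
    compute_degree!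
  have hl0 : l ≠ 0 := by
    intro h0
    have h1 := congrArg (fun r => Polynomial.coeff r 1) h0
    have h3 := congrArg (fun r => Polynomial.coeff r 0) h0
    simp [hl, h4] at h1 h3
    exact h34.elim (fun h => h h1) (fun h => h h3)
  have hldeg : l.natDegree ≤ 1 := by
    rw [hl]
    compute_degree
  -- `(q - p)(q + p) = l` is impossible: one factor has degree at least `2`
  have hfac : (q - p) * (q + p) = l := by linear_combination -hq
  have hm : q - p ≠ 0 := by
    intro h0
    rw [h0, zero_mul] at hfac
    exact hl0 hfac.symm
  have hn : q + p ≠ 0 := by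
    intro h0
    rw [h0, mul_zero] at hfac
    exact hl0 hfac.symm
  have hdeg := congrArg Polynomial.natDegree hfac
  rw [Polynomial.natDegree_mul hm hn] at hdeg
  have h2p : (Polynomial.C 2 * p).natDegree = 2 := by
    rw [Polynomial.natDegree_C_mul h2, hpdeg]
  have : Polynomial.C 2 * p = (q + p) - (q - p) := by
    rw [show (Polynomial.C 2 : k[X]) = 2 from rfl]
    ring
  rw [this] at h2p
  have := Polynomial.natDegree_sub_le (q + p) (q - p)
  omega

/-- A presentation of `E` as a curve `w² = h(x, y)` whose points on the line `y = 0` correspond to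
the identity element and to `P`. The conditions on `h` hold automatically but are convenient to
carry along. -/
structure IsPresentation {E : WeierstrassCurve k} (P : (weierstrassCurve E).Point)
    {h : homogeneousSubmodule (Fin 2) k 4}
    (φ : (quarticCurve h).Point ≃ (weierstrassCurve E).Point) : Prop where
  natDegree : 3 ≤ (dehom h).natDegree
  not_isSquare : ¬ IsSquare (dehom h)
  isIso : IsIso φ
  atInfinity : ∃ (s : AlgebraicClosure k) (Q R : (quarticCurve h).Cone (AlgebraicClosure k)),
    Q.1 = ![1, 0, s] ∧ R.1 = ![1, 0, -s] ∧ φ (Point.mk Q) = weierstrassOrigin E ∧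
      φ (Point.mk R) = P

theorem exists_isPresentation_origin (h2 : (2 : k) ≠ 0) (E : WeierstrassCurve k) :
    ∃ (h : homogeneousSubmodule (Fin 2) k 4)
      (φ : (quarticCurve h).Point ≃ (weierstrassCurve E).Point),
      IsPresentation (weierstrassOrigin E) φ := by
  have h2' : (2 : AlgebraicClosure k) ≠ 0 := by
    have := (map_ne_zero (algebraMap k (AlgebraicClosure k))).2 h2
    rwa [map_ofNat] at this
  obtain ⟨φ, hφ, hφ'⟩ := exists_isIso_formO h2 E
  let Q := coneMk (formO E) 1 0 0 (Or.inl one_ne_zero) (by rw [aeval_formO]; simp [quarticO])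
  have hQ : φ (Point.mk Q) = weierstrassOrigin E := by
    obtain ⟨R, hR, hR'⟩ := exists_mk_eq (C := weierstrassCurve E) (u := ![0, 2, 0])
      (v := ⟨![0, 1, 0], fun h => one_ne_zero (congrFun h 1), by
        simp [weierstrassCurve, WeierstrassCurve.Projective.polynomial]⟩) h2' (fun i => by
          fin_cases i <;> simp [weierstrassCurve])
    refine (hφ' 1 Q R fun i => ?_).trans hR'
    rw [hR]
    fin_cases i <;> simp [toCubicO, Q, coneMk]
  exact ⟨formO E, φ, (dehom_formO_natDegree h2 E).ge, dehom_formO_not_isSquare h2 E, hφ,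
    0, Q, Q, rfl, by simp [Q, coneMk], hQ, hQ⟩

/-- If `(0, 0)` lies on `E`, the points on the line `y = 0` of the curve obtained by projecting from
it are the identity and the second point of `E` above `x = 0`, which is the inverse of `(0, 0)`. -/
theorem exists_isPresentation_of_a₆_eq_zero (h2 : (2 : k) ≠ 0) (E : WeierstrassCurve k) (h6 : E.a₆ = 0)
    (h34 : E.a₃ ≠ 0 ∨ E.a₄ ≠ 0) (P : (weierstrassCurve E).Cone (AlgebraicClosure k))
    (hP : P.1 = ![0, -algebraMap k _ E.a₃, 1]) :
    ∃ (h : homogeneousSubmodule (Fin 2) k 4)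
      (φ : (quarticCurve h).Point ≃ (weierstrassCurve E).Point),
      IsPresentation (Point.mk P) φ := by
  have h2' : (2 : AlgebraicClosure k) ≠ 0 := by
    have := (map_ne_zero (algebraMap k (AlgebraicClosure k))).2 h2
    rwa [map_ofNat] at this
  obtain ⟨φ, hφ, hφ'⟩ := exists_isIso_formP h2 E h6 h34
  let Q := coneMk (formP E) 1 0 1 (Or.inl one_ne_zero) (by rw [aeval_formP]; simp [quarticP, quadP])
  let R := coneMk (formP E) 1 0 (-1) (Or.inl one_ne_zero)
    (by rw [aeval_formP]; simp [quarticP, quadP])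
  refine ⟨formP E, φ, by rw [dehom_formP_natDegree]; omega, dehom_formP_not_isSquare h2 E h34, hφ,
    1, Q, R, rfl, rfl, ?_, ?_⟩
  · obtain ⟨R, hR, hR'⟩ := exists_mk_eq (C := weierstrassCurve E) (u := ![0, 2, 0])
      (v := ⟨![0, 1, 0], fun h => one_ne_zero (congrFun h 1), by
        simp [weierstrassCurve, WeierstrassCurve.Projective.polynomial]⟩) h2' (fun i => by
          fin_cases i <;> simp [weierstrassCurve])
    refine (hφ' 1 Q R fun i => ?_).trans hR'
    rw [hR]
    fin_cases i <;> simp [toCubicP, Q, coneMk, quadP, one_add_one_eq_two]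
  · obtain ⟨S, hS, hS'⟩ := exists_mk_eq (C := weierstrassCurve E)
      (u := ![0, 2 * algebraMap k _ E.a₃, -2]) (v := P) (neg_ne_zero.2 h2') (fun i => by
          rw [hP]
          fin_cases i <;> simp [weierstrassCurve])
    refine (hφ' 0 R S fun i => ?_).trans hS'
    rw [hS]
    fin_cases i <;> simp [toCubicP, R, coneMk, quadP, linP]
    norm_num

/-- The change of variables `(x, y) ↦ (x + r, y + t)` is an isomorphism of curves. -/
theorem exists_isIso_translate (E : WeierstrassCurve k) (r t : k) :
    ∃ φ : (weierstrassCurve ((⟨1, r, 0, t⟩ : WeierstrassCurve.VariableChange k) • E)).Point ≃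
        (weierstrassCurve E).Point, IsIso φ ∧ ∀ Q R,
      R.1 = ![Q.1 0 + algebraMap k _ r * Q.1 2, Q.1 1 + algebraMap k _ t * Q.1 2, Q.1 2] →
      φ (Point.mk Q) = Point.mk R := by
  set E' := (⟨1, r, 0, t⟩ : WeierstrassCurve.VariableChange k) • E with hE'
  have hcub : ∀ v : Fin 3 → AlgebraicClosure k, aeval v (weierstrassCurve E').poly =
      aeval (![v 0 + algebraMap k _ r * v 2, v 1 + algebraMap k _ t * v 2, v 2] :
        Fin 3 → AlgebraicClosure k) (weierstrassCurve E).poly := fun v => by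
    rw [aeval_weierstrass, aeval_weierstrass]
    simp [cubic, hE', WeierstrassCurve.variableChange_a₁, WeierstrassCurve.variableChange_a₂,
      WeierstrassCurve.variableChange_a₃, WeierstrassCurve.variableChange_a₄,
      WeierstrassCurve.variableChange_a₆]
    rw [show algebraMap k (AlgebraicClosure k) 2 = 2 from map_ofNat _ 2,
      show algebraMap k (AlgebraicClosure k) 3 = 3 from map_ofNat _ 3]
    ring
  have hev : ∀ (r t : k) (v : Fin 3 → AlgebraicClosure k),
      (fun i => aeval v ((![X 0 + C r * X 2, X 1 + C t * X 2, X 2] :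
        Fin 3 → MvPolynomial (Fin 3) k) i)) =
      ![v 0 + algebraMap k _ r * v 2, v 1 + algebraMap k _ t * v 2, v 2] := fun r t v => by
    ext i
    fin_cases i <;> simp
  have hhom : ∀ (r t : k) (i : Fin 3), ((![X 0 + C r * X 2, X 1 + C t * X 2, X 2] :
      Fin 3 → MvPolynomial (Fin 3) k) i).IsWeightedHomogeneous 1 (1 * (1 : Fin 3 → ℕ) i) :=
    fun r t i => IsWeightedHomogeneous.of_aeval fun t v => by
      fin_cases i <;> simp <;> ring
  have hne : ∀ (r t : k) (v : Fin 3 → AlgebraicClosure k), v ≠ 0 → ∃ i,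
      (![v 0 + algebraMap k _ r * v 2, v 1 + algebraMap k _ t * v 2, v 2] :
        Fin 3 → AlgebraicClosure k) i ≠ 0 := fun r t v hv => by
    by_contra! h
    have h0 := h 0
    have h1 := h 1
    have h3 := h 2
    simp only [Matrix.cons_val_zero, Matrix.cons_val_one, Matrix.cons_val] at h0 h1 h3
    rw [h3, mul_zero, add_zero] at h0 h1
    exact hv (by ext i; fin_cases i <;> assumption)
  obtain ⟨φ, hφ, hφ'⟩ := exists_isIso_of_charts (C := weierstrassCurve E')
    (D := weierstrassCurve E) (ι := Unit) (κ := Unit)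
    (fun _ => 1) (fun _ => ![X 0 + C r * X 2, X 1 + C t * X 2, X 2])
    (fun _ => 1) (fun _ => ![X 0 + C (-r) * X 2, X 1 + C (-t) * X 2, X 2])
    (fun _ => hhom r t) (fun _ => hhom (-r) (-t))
    (fun _ Q => by rw [hev, ← hcub, Q.2.2])
    (fun _ Q => by
      rw [hev, hcub]
      refine Eq.trans ?_ Q.2.2
      congr 2
      ext i
      fin_cases i <;> simp)
    (fun Q => ⟨(), by simpa only [← hev] using hne r t Q.1 Q.2.1⟩)
    (fun Q => ⟨(), by simpa only [← hev] using hne (-r) (-t) Q.1 Q.2.1⟩)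
    (fun _ _ Q => ⟨1, fun i => by
      rw [hev, one_pow, one_mul]
      refine (congrFun (hev _ _ _) i).trans ?_
      fin_cases i <;> simp⟩)
    (fun _ _ Q => ⟨1, fun i => by
      rw [hev, one_pow, one_mul]
      refine (congrFun (hev _ _ _) i).trans ?_
      fin_cases i <;> simp⟩)
  refine ⟨φ, hφ, fun Q R hR => hφ' () Q R fun i => ?_⟩
  rw [hR]
  exact (congrFun (hev r t Q.1) i).symm

theorem exists_isPresentation_of_affine (h2 : (2 : k) ≠ 0) (E : WeierstrassCurve k)
    [E.IsElliptic] {x y : k}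
    (heq : y ^ 2 + E.a₁ * x * y + E.a₃ * y - (x ^ 3 + E.a₂ * x ^ 2 + E.a₄ * x + E.a₆) = 0)
    (P : (weierstrassCurve E).Cone (AlgebraicClosure k))
    (hP : P.1 = ![algebraMap k _ x, algebraMap k _ y, 1]) :
    ∃ (h : homogeneousSubmodule (Fin 2) k 4)
      (φ : (quarticCurve h).Point ≃ (weierstrassCurve E).Point), IsPresentation (Point.mk P) φ := by
  -- translate `-P` to the point `(0, 0)`
  obtain ⟨t, ht⟩ : ∃ t, t = -y - E.a₁ * x - E.a₃ := ⟨_, rfl⟩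
  have hψ := exists_isIso_translate E x t
  obtain ⟨E', hE'⟩ : ∃ E', (⟨1, x, 0, t⟩ : WeierstrassCurve.VariableChange k) • E = E' := ⟨_, rfl⟩
  have hell : E'.IsElliptic := hE' ▸ inferInstance
  have h3 : E'.a₃ = t - y := by
    rw [← hE', WeierstrassCurve.variableChange_a₃]
    simp only [inv_one, Units.val_one, one_pow, one_mul]
    rw [ht]
    ring
  have h6 : E'.a₆ = 0 := by
    rw [← hE', WeierstrassCurve.variableChange_a₆]
    simp only [inv_one, Units.val_one, one_pow, one_mul]
    rw [ht]
    linear_combination -heq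
  rw [hE'] at hψ
  clear hE'
  obtain ⟨ψ, hψ, hψ'⟩ := hψ
  have h34 : E'.a₃ ≠ 0 ∨ E'.a₄ ≠ 0 := by
    by_contra! h0
    refine E'.isUnit_Δ.ne_zero ?_
    simp [WeierstrassCurve.Δ, WeierstrassCurve.b₂, WeierstrassCurve.b₄, WeierstrassCurve.b₆,
      WeierstrassCurve.b₈, h0.1, h0.2, h6]
  obtain ⟨P', hP'⟩ : ∃ P' : (weierstrassCurve E').Cone (AlgebraicClosure k),
      P'.1 = ![0, -algebraMap k _ E'.a₃, 1] :=
    ⟨⟨![0, -algebraMap k _ E'.a₃, 1], fun h => one_ne_zero (congrFun h 2), by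
      rw [aeval_weierstrass]
      simp [cubic, h6]
      ring⟩, rfl⟩
  obtain ⟨h, φ, hφ⟩ := exists_isPresentation_of_a₆_eq_zero h2 E' h6 h34 P' hP'
  obtain ⟨s, Q, R, hQ, hR, hQ', hR'⟩ := hφ.atInfinity
  refine ⟨h, φ.trans ψ, hφ.natDegree, hφ.not_isSquare, hφ.isIso.trans hψ, s, Q, R, hQ, hR, ?_, ?_⟩
  · rw [Equiv.trans_apply, hQ']
    refine hψ' _ _ ?_
    ext i
    fin_cases i <;> simp
  · rw [Equiv.trans_apply, hR']
    refine hψ' _ _ ?_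
    rw [hP, hP']
    ext i
    fin_cases i <;> simp [h3]

theorem mk_eq_origin (E : WeierstrassCurve k) {v : Fin 3 → k} (hz : v 2 = 0)
    (hcub : cubic E.a₁ E.a₂ E.a₃ E.a₄ E.a₆ v = 0)
    (P : (weierstrassCurve E).Cone (AlgebraicClosure k))
    (hP : P.1 = fun i => algebraMap k _ (v i)) : Point.mk P = weierstrassOrigin E := by
  have hx : v 0 = 0 := by
    have : v 0 ^ 3 = 0 := by
      simp only [cubic, hz] at hcub
      linear_combination -hcub
    exact pow_eq_zero_iff three_ne_zero |>.1 this
  have hy : v 1 ≠ 0 := fun hy => P.2.1 (by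
    rw [hP]
    ext i
    fin_cases i <;> simp [hx, hy, hz])
  refine (Point.mk_eq_mk.2 ⟨algebraMap k _ (v 1), by simpa using hy, fun i => ?_⟩).symm
  rw [hP]
  fin_cases i <;> simp [weierstrassCurve, hx, hz]

/-- Every rational point of an elliptic curve is obtained from a presentation. -/
theorem exists_isPresentation (h2 : (2 : k) ≠ 0) (E : WeierstrassCurve k) [E.IsElliptic]
    {P : (weierstrassCurve E).Point} (hP : P.IsRational) :
    ∃ (h : homogeneousSubmodule (Fin 2) k 4)
      (φ : (quarticCurve h).Point ≃ (weierstrassCurve E).Point), IsPresentation P φ := by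
  obtain ⟨v, hv, rfl⟩ := hP
  have hcub : cubic E.a₁ E.a₂ E.a₃ E.a₄ E.a₆ v = 0 := by
    have := hv.2
    rw [aeval_algebraMap_comp, map_eq_zero, ← coe_aeval_eq_eval, RingHom.coe_coe,
      aeval_weierstrass] at this
    exact this
  by_cases hz : v 2 = 0
  · rw [mk_eq_origin E hz hcub ⟨_, hv⟩ rfl]
    exact exists_isPresentation_origin h2 E
  · obtain ⟨x, hx⟩ : ∃ x, v 0 = v 2 * x := ⟨v 0 / v 2, by field_simp⟩
    obtain ⟨y, hy⟩ : ∃ y, v 1 = v 2 * y := ⟨v 1 / v 2, by field_simp⟩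
    obtain ⟨S, hS, hS'⟩ := exists_mk_eq (C := weierstrassCurve E)
      (u := ![algebraMap k _ x, algebraMap k _ y, 1]) (v := ⟨_, hv⟩)
      (t := (algebraMap k (AlgebraicClosure k) (v 2))⁻¹) (inv_ne_zero (by simpa using hz))
      (fun i => by
        have : algebraMap k (AlgebraicClosure k) (v 2) ≠ 0 := by simpa using hz
        fin_cases i <;> simp [weierstrassCurve, hx, hy, this])
    rw [← hS']
    refine exists_isPresentation_of_affine h2 E ?_ S hS
    refine (mul_eq_zero.1 ?_).resolve_left (pow_ne_zero 3 hz)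
    simp only [cubic, hx, hy] at hcub
    linear_combination hcub

end WeierstrassChart

/-! ### The involution `w ↦ -w` -/

namespace QuarticCurve

open WeightedPlaneCurve

variable {k : Type*} [Field k] {f h : homogeneousSubmodule (Fin 2) k 4}

theorem exists_isLinear_one_neg_one (f : homogeneousSubmodule (Fin 2) k 4) :
    ∃ ι : (quarticCurve f).Point ≃ (quarticCurve f).Point, IsLinear 1 (-1) ι := by
  have hf : formSubst (1 : GL (Fin 2) k).1 (((-1 : kˣ) : k) ^ 2)⁻¹ f = f :=
    form_ext fun x y => by
      rw [aeval_formSubst]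
      simp
  have := (exists_isLinear f 1 (-1)).imp fun _ h => h.2
  rwa [hf] at this

/-- The involution `w ↦ -w` of the curve `w² = f(x, y)`. -/
noncomputable def involution (f : homogeneousSubmodule (Fin 2) k 4) :
    (quarticCurve f).Point ≃ (quarticCurve f).Point :=
  (exists_isLinear_one_neg_one f).choose

theorem isLinear_involution : IsLinear 1 (-1) (involution f) :=
  (exists_isLinear_one_neg_one f).choose_spec

theorem involution_mk {Q R : (quarticCurve f).Cone (AlgebraicClosure k)}
    (h : R.1 = ![Q.1 0, Q.1 1, -Q.1 2]) : involution f (Point.mk Q) = Point.mk R := by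
  obtain ⟨S, hS, hS'⟩ := isLinear_involution Q
  rw [hS']
  congr 1
  apply Subtype.ext
  rw [hS, h]
  ext i
  fin_cases i <;> simp [linVec]

/-- Linear maps commute with the involutions. -/
theorem IsLinear.apply_involution {g : GL (Fin 2) k} {e : kˣ}
    {φ : (quarticCurve f).Point ≃ (quarticCurve h).Point} (hφ : IsLinear g e φ)
    (P : (quarticCurve f).Point) : φ (involution f P) = involution h (φ P) := by
  have h1 := isLinear_involution.trans hφ
  have h2 := hφ.trans isLinear_involution
  rw [mul_one, mul_neg_one] at h1
  rw [one_mul, neg_one_mul] at h2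
  exact DFunLike.congr_fun (h1.ext h2) P

/-- The points on the line `y = 0` are one orbit of the involution. -/
theorem atInfinity_iff {Q : (quarticCurve f).Cone (AlgebraicClosure k)} (hQ : Q.1 1 = 0)
    {P : (quarticCurve f).Point} :
    AtInfinity P ↔ P = Point.mk Q ∨ P = involution f (Point.mk Q) := by
  obtain ⟨R, hR, hR'⟩ := isLinear_involution Q
  have hR0 : R.1 0 = Q.1 0 := by rw [hR]; simp [linVec]
  have hR1 : R.1 1 = 0 := by rw [hR]; simp [linVec, hQ]
  have hR2 : R.1 2 = -Q.1 2 := by rw [hR]; simp [linVec]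
  rw [hR']
  constructor
  · rintro ⟨S, rfl, hS⟩
    have hQ0 := (cone_ne_zero Q).resolve_right fun h => h hQ
    have hS0 := (cone_ne_zero S).resolve_right fun h => h hS
    obtain ⟨t, ht⟩ : ∃ t, S.1 0 = t * Q.1 0 := ⟨S.1 0 / Q.1 0, by field_simp⟩
    have ht0 : t ≠ 0 := by
      rintro rfl
      exact hS0 (by rw [ht, zero_mul])
    have h1 : S.1 2 ^ 2 = (t ^ 2 * Q.1 2) ^ 2 := by
      have h2 := form_smul (f := f) t (Q.1 0) 0
      rw [mul_zero] at h2
      rw [cone_sq, hS, ht, h2, mul_pow, cone_sq, hQ]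
      ring
    rcases sq_eq_sq_iff_eq_or_eq_neg.1 h1 with h1 | h1
    · exact Or.inl (mk_eq_mk.2 ⟨t, ht0, ht, by rw [hS, hQ, mul_zero], h1⟩).symm
    · exact Or.inr (mk_eq_mk.2 ⟨t, ht0, by rw [ht, hR0], by rw [hS, hR1, mul_zero],
        by rw [h1, hR2, mul_neg]⟩).symm
  · rintro (rfl | rfl)
    · exact atInfinity_mk.2 hQ
    · exact atInfinity_mk.2 hR1

end QuarticCurve

namespace WeierstrassChart

open WeightedPlaneCurve QuarticCurve

variable {k : Type*} [Field k] {E : WeierstrassCurve k} {f h : homogeneousSubmodule (Fin 2) k 4}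

theorem isRational_origin (E : WeierstrassCurve k) : (weierstrassOrigin E).IsRational := by
  have h0 : (fun i => algebraMap k (AlgebraicClosure k) ((![0, 1, 0] : Fin 3 → k) i)) =
      ![0, 1, 0] := by
    ext i
    fin_cases i <;> simp
  refine ⟨![0, 1, 0], by
    rw [h0]
    exact ⟨fun h => one_ne_zero (congrFun h 1), by
      simp [weierstrassCurve, WeierstrassCurve.Projective.polynomial]⟩, ?_⟩
  rw [weierstrassOrigin]
  congr 1
  exact Subtype.ext h0.symm

/-- The image of the identity element under the involution `w ↦ -w` transported to `E` along an
isomorphism. -/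
noncomputable def mirror (φ : (quarticCurve f).Point ≃ (weierstrassCurve E).Point) :
    (weierstrassCurve E).Point :=
  φ (involution f (φ.symm (weierstrassOrigin E)))

theorem isRational_mirror {φ : (quarticCurve f).Point ≃ (weierstrassCurve E).Point}
    (hφ : IsIso φ) : (mirror φ).IsRational :=
  hφ.1.isRational (isLinear_involution.isIso.1.isRational (hφ.2.isRational (isRational_origin E)))

theorem mirror_trans_of_isLinear {g : GL (Fin 2) k} {e : kˣ}
    {χ : (quarticCurve f).Point ≃ (quarticCurve h).Point} (hχ : IsLinear g e χ)
    (φ : (quarticCurve h).Point ≃ (weierstrassCurve E).Point) :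
    mirror (χ.trans φ) = mirror φ := by
  rw [mirror, mirror, Equiv.symm_trans_apply, Equiv.trans_apply, hχ.apply_involution,
    Equiv.apply_symm_apply]

theorem IsPresentation.mirror_eq {P : (weierstrassCurve E).Point}
    {φ : (quarticCurve h).Point ≃ (weierstrassCurve E).Point} (hφ : IsPresentation P φ) :
    mirror φ = P := by
  obtain ⟨s, Q, R, hQ, hR, hQ', hR'⟩ := hφ.atInfinity
  rw [mirror, ← hQ', Equiv.symm_apply_apply, involution_mk (R := R), hR']
  rw [hR, hQ]
  simp

/-- A linear change of coordinates moves a given rational point to the line `y = 0`. -/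
theorem exists_isLinear_symm_apply {P : (quarticCurve f).Point} (hP : P.IsRational) :
    ∃ (f' : homogeneousSubmodule (Fin 2) k 4) (g : GL (Fin 2) k) (e : kˣ)
      (ρ : (quarticCurve f').Point ≃ (quarticCurve f).Point)
      (Z : (quarticCurve f').Cone (AlgebraicClosure k)),
      IsLinear g e ρ ∧ ρ.symm P = Point.mk Z ∧ Z.1 1 = 0 := by
  obtain ⟨v, hv, rfl⟩ := hP
  have h0 : v 0 ≠ 0 ∨ v 1 ≠ 0 := by simpa using cone_ne_zero ⟨_, hv⟩
  obtain ⟨g, h00, h10⟩ : ∃ g : GL (Fin 2) k, g.1 0 0 = v 0 ∧ g.1 1 0 = v 1 := by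
    rcases h0 with h0 | h0
    · exact ⟨Matrix.GeneralLinearGroup.mkOfDetNeZero !![v 0, 0; v 1, 1]
        (by simpa [Matrix.det_fin_two] using h0), rfl, rfl⟩
    · exact ⟨Matrix.GeneralLinearGroup.mkOfDetNeZero !![v 0, 1; v 1, 0]
        (by simpa [Matrix.det_fin_two] using h0), rfl, rfl⟩
  obtain ⟨ρ, -, hρ⟩ := exists_isLinear f g 1
  obtain ⟨Z, hZ, hZ'⟩ := hρ.symm ⟨_, hv⟩
  refine ⟨_, g, 1, ρ, Z, hρ, hZ', ?_⟩
  have h1 : (fun i => algebraMap k (AlgebraicClosure k) (v i)) =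
      linVec g.1 (1 : kˣ) ![1, 0, algebraMap k _ (v 2)] := by
    ext i
    fin_cases i <;> simp [linVec, h00, h10]
  rw [hZ]
  dsimp only
  rw [h1, linVec_inv]
  rfl

/-- Two isomorphisms onto `E` which transport the involutions `w ↦ -w` to involutions of `E` with
the same value at the identity differ by a linear map. -/
theorem IsPresentation.exists_isLinear (h2 : (2 : k) ≠ 0) {P : (weierstrassCurve E).Point}
    {φ : (quarticCurve h).Point ≃ (weierstrassCurve E).Point} (hφ : IsPresentation P φ)
    {ψ : (quarticCurve f).Point ≃ (weierstrassCurve E).Point} (hψ : IsIso ψ) (hP : mirror ψ = P) :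
    ∃ g e, IsLinear g e (ψ.trans φ.symm) := by
  obtain ⟨s, Q, R, hQ, hR, hQ', hR'⟩ := hφ.atInfinity
  have hQR : involution h (Point.mk Q) = Point.mk R := involution_mk (by rw [hR, hQ]; simp)
  -- move `ψ⁻¹(O)` to the line `y = 0`
  obtain ⟨f', g, e, ρ, Z, hρ, hZ, hZ1⟩ :=
    exists_isLinear_symm_apply (hψ.2.isRational (isRational_origin E))
  obtain ⟨χ, hχ⟩ : ∃ χ : (quarticCurve h).Point ≃ (quarticCurve f').Point,
      χ = (φ.trans ψ.symm).trans ρ.symm := ⟨_, rfl⟩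
  have hχ' : IsIso χ := hχ ▸ (hφ.isIso.trans hψ.symm).trans hρ.symm.isIso
  have h3 : χ (Point.mk Q) = Point.mk Z := by
    rw [hχ, Equiv.trans_apply, Equiv.trans_apply, hQ', hZ]
  have h4 : χ (involution h (Point.mk Q)) = involution f' (Point.mk Z) := by
    rw [hQR, ← hZ, ← hρ.symm.apply_involution, hχ, Equiv.trans_apply, Equiv.trans_apply, hR',
      ← hP, mirror, Equiv.symm_apply_apply]
  have hQ1 : Q.1 1 = 0 := by rw [hQ]; rfl
  obtain ⟨g', e', hlin⟩ := exists_isLinear_of_isIso h2 hφ.natDegree hφ.not_isSquare hχ' fun X => by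
    rw [atInfinity_iff hZ1, atInfinity_iff hQ1, ← h4, ← h3, χ.injective.eq_iff,
      χ.injective.eq_iff]
  have h5 := (hlin.trans hρ).symm
  have h6 : (χ.trans ρ).symm = ψ.trans φ.symm := by
    rw [hχ]
    ext X
    simp
  rw [h6] at h5
  exact ⟨_, _, h5⟩

end WeierstrassChart

/-! ### Counting -/

/-- A map whose fibres are all equivalent to `γ` is, up to equivalence, a projection. -/
theorem nonempty_equiv_prod_of_fibers {α β γ : Type*} (f : α → β)
    (H : ∀ b, Nonempty ({a // f a = b} ≃ γ)) : Nonempty (α ≃ β × γ) :=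
  ⟨(Equiv.sigmaFiberEquiv f).symm.trans
    ((Equiv.sigmaCongrRight fun b => (H b).some).trans (Equiv.sigmaEquivProd β γ))⟩

namespace WeierstrassChart

open WeightedPlaneCurve QuarticCurve

variable {k : Type*} [Field k] {E : WeierstrassCurve k} {f h : homogeneousSubmodule (Fin 2) k 4}

/-- The isomorphisms of curves from `w² = f(x, y)` to `E`, for all quartic forms `f`. -/
def Parametrization (E : WeierstrassCurve k) : Type _ :=
  Σ f : homogeneousSubmodule (Fin 2) k 4,
    {φ : (quarticCurve f).Point ≃ (weierstrassCurve E).Point // IsIso φ}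

/-- The rational points of `E`. -/
def RationalPoint (E : WeierstrassCurve k) : Type _ :=
  {P : (weierstrassCurve E).Point // P.IsRational}

/-- The automorphisms of the curve `E`, which need not fix the identity element. -/
def CurveAut (E : WeierstrassCurve k) : Type _ :=
  {φ : (weierstrassCurve E).Point ≃ (weierstrassCurve E).Point // IsIso φ}

/-- The rational point attached to a parametrization. -/
noncomputable def Parametrization.point (τ : Parametrization E) : RationalPoint E :=
  ⟨mirror τ.2.1, isRational_mirror τ.2.2⟩

/-- A parametrization is determined by a linear comparison with a fixed isomorphism onto `E`. -/
theorem Parametrization.ext {τ τ' : Parametrization E} {g : GL (Fin 2) k} {e : kˣ}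
    {φ : (quarticCurve h).Point ≃ (weierstrassCurve E).Point}
    (hτ : IsLinear g e (τ.2.1.trans φ.symm)) (hτ' : IsLinear g e (τ'.2.1.trans φ.symm)) :
    τ = τ' := by
  obtain ⟨f, ψ, hψ⟩ := τ
  obtain ⟨f', ψ', hψ'⟩ := τ'
  obtain rfl : f = f' := hτ.aeval_eq.symm.trans hτ'.aeval_eq
  have h1 := hτ.ext hτ'
  have h2 : ψ = ψ' := by
    ext X
    exact φ.symm.injective (DFunLike.congr_fun h1 X)
  subst h2
  rfl

/-- The pairs inducing a given linear map form a torsor under the scalings `(t, t²)`. -/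
theorem nonempty_units_equiv (hf : f ≠ 0) {g : GL (Fin 2) k} {e : kˣ}
    {χ : (quarticCurve f).Point ≃ (quarticCurve h).Point} (hχ : IsLinear g e χ) :
    Nonempty (kˣ ≃ {x : GL (Fin 2) k × kˣ // IsLinear x.1 x.2 χ}) := by
  have hdet : ∀ t : kˣ, ((t : k) • g.1).det ≠ 0 := fun t => by
    rw [Matrix.det_smul]
    exact mul_ne_zero (pow_ne_zero _ t.ne_zero) g.det.ne_zero
  let F : kˣ → {x : GL (Fin 2) k × kˣ // IsLinear x.1 x.2 χ} := fun t =>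
    ⟨(Matrix.GeneralLinearGroup.mkOfDetNeZero _ (hdet t), t ^ 2 * e), hχ.smul rfl rfl⟩
  refine ⟨Equiv.ofBijective F ⟨fun t t' h => ?_, fun ⟨x, hx⟩ => ?_⟩⟩
  · have h1 : (t : k) • g.1 = (t' : k) • g.1 := congrArg (fun x => x.1.1.1) h
    exact Units.ext (smul_left_injective k g.isUnit.ne_zero h1)
  · obtain ⟨t, h1, h2⟩ := hχ.exists_smul_eq hf hx
    exact ⟨t, Subtype.ext (Prod.ext (Units.ext h1.symm) h2.symm)⟩

/-- The pairs `(g, e)` of an invertible matrix and a nonzero scalar describe the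
parametrizations of `E` with a given rational point, up to the scalings `(t, t²)`. -/
theorem nonempty_equiv_fiber (h2 : (2 : k) ≠ 0) [E.IsElliptic] (P : RationalPoint E) :
    Nonempty (GL (Fin 2) k × kˣ ≃ {τ : Parametrization E // τ.point = P} × kˣ) := by
  obtain ⟨h, φ, hφ⟩ := exists_isPresentation h2 E P.2
  have hpar : ∀ x : GL (Fin 2) k × kˣ, ∃ τ : {τ : Parametrization E // τ.point = P},
      IsLinear x.1 x.2 (τ.1.2.1.trans φ.symm) := fun x => by
    obtain ⟨χ, hχ, hlin⟩ := exists_isLinear h x.1 x.2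
    refine ⟨⟨⟨_, χ.trans φ, hχ.trans hφ.isIso⟩, Subtype.ext ?_⟩, ?_⟩
    · exact (mirror_trans_of_isLinear hlin φ).trans hφ.mirror_eq
    · dsimp only
      rwa [Equiv.trans_assoc, Equiv.self_trans_symm, Equiv.trans_refl]
  choose Φ hΦ using hpar
  refine nonempty_equiv_prod_of_fibers Φ fun τ => ?_
  have hfib : ∀ x, Φ x = τ ↔ IsLinear x.1 x.2 (τ.1.2.1.trans φ.symm) := fun x =>
    ⟨fun hx => hx ▸ hΦ x, fun hx => Subtype.ext (Parametrization.ext (hΦ x) hx)⟩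
  obtain ⟨g, e, hlin⟩ := hφ.exists_isLinear h2 τ.1.2.2 (congrArg Subtype.val τ.2)
  have hf : τ.1.1 ≠ 0 := fun h0 => by
    have hh : h ≠ 0 := by
      rintro rfl
      have := hφ.natDegree
      simp [dehom] at this
    refine hh ?_
    rw [← hlin.symm.aeval_eq, h0]
    simp [formSubst]
  exact (nonempty_units_equiv hf hlin).map fun u => (Equiv.subtypeEquivRight hfib).trans u.symm

/-- The involutions `w ↦ -w` show that the automorphism group of the curve `E` is transitive on
the rational points. -/
theorem exists_isIso_apply_origin (h2 : (2 : k) ≠ 0) [E.IsElliptic] (P : RationalPoint E) :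
    ∃ σ : (weierstrassCurve E).Point ≃ (weierstrassCurve E).Point,
      IsIso σ ∧ σ (weierstrassOrigin E) = P.1 := by
  obtain ⟨h, φ, hφ⟩ := exists_isPresentation h2 E P.2
  exact ⟨(φ.symm.trans (involution h)).trans φ,
    (hφ.isIso.symm.trans isLinear_involution.isIso).trans hφ.isIso, hφ.mirror_eq⟩

theorem nonempty_curveAut_equiv (h2 : (2 : k) ≠ 0) (E : WeierstrassCurve k) [E.IsElliptic] :
    Nonempty (CurveAut E ≃ RationalPoint E × EllipticAut E) := by
  refine nonempty_equiv_prod_of_fibers (fun φ : CurveAut E =>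
    (⟨φ.1 (weierstrassOrigin E), φ.2.1.isRational (isRational_origin E)⟩ : RationalPoint E))
    fun P => ?_
  obtain ⟨σ, hσ, hσ'⟩ := exists_isIso_apply_origin h2 P
  refine ⟨⟨fun φ => ⟨φ.1.1.trans σ.symm, φ.1.2.trans hσ.symm, ?_⟩,
    fun ψ => ⟨⟨ψ.1.trans σ, ψ.2.1.trans hσ⟩, Subtype.ext ?_⟩, fun φ => ?_, fun ψ => ?_⟩⟩
  · rw [Equiv.trans_apply, Equiv.symm_apply_eq, hσ']
    exact congrArg Subtype.val φ.2
  · dsimp only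
    rw [Equiv.trans_apply, ψ.2.2, hσ']
  · apply Subtype.ext
    apply Subtype.ext
    ext X
    simp
  · apply Subtype.ext
    ext X
    simp

theorem nonempty_parametrization_equiv (E : WeierstrassCurve k) :
    Nonempty (Parametrization E ≃ quarticsIsomorphicTo E × CurveAut E) := by
  refine nonempty_equiv_prod_of_fibers (fun τ : Parametrization E =>
    (⟨τ.1, τ.2.1, τ.2.2⟩ : quarticsIsomorphicTo E)) fun f => ?_
  obtain ⟨f, φ, hφ⟩ := f
  let F : CurveAut E → {τ : Parametrization E //
      (⟨τ.1, τ.2.1, τ.2.2⟩ : quarticsIsomorphicTo E) = ⟨f, φ, hφ⟩} := fun ψ =>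
    ⟨⟨f, φ.trans ψ.1, hφ.trans ψ.2⟩, rfl⟩
  refine ⟨(Equiv.ofBijective F ⟨fun ψ ψ' hψ => Subtype.ext ?_, ?_⟩).symm⟩
  · have h1 := eq_of_heq (Sigma.ext_iff.1 (congrArg Subtype.val hψ)).2
    have h2 : φ.trans ψ.1 = φ.trans ψ'.1 := congrArg Subtype.val h1
    ext X
    simpa using DFunLike.congr_fun h2 (φ.symm X)
  · rintro ⟨⟨f', χ, hχ⟩, hf⟩
    obtain rfl : f' = f := congrArg Subtype.val hf
    refine ⟨⟨φ.symm.trans χ, hφ.symm.trans hχ⟩, Subtype.ext (Sigma.ext rfl (heq_of_eq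
      (Subtype.ext ?_)))⟩
    ext X
    simp [F]

/-- Counting parametrizations in two ways: over the rational points of `E`, and over the forms `f`
with `w² = f` isomorphic to `E`. -/
theorem card_quartics_mul_card_aut [Finite k] (h2 : (2 : k) ≠ 0) (E : WeierstrassCurve k)
    [E.IsElliptic] : Nat.card (quarticsIsomorphicTo E) * Nat.card (EllipticAut E) =
      Nat.card (GL (Fin 2) k) := by
  have hfin : Finite (RationalPoint E) := (finite_isRational (C := weierstrassCurve E)).to_subtype
  have hne : Nonempty (RationalPoint E) := ⟨⟨_, isRational_origin E⟩⟩
  obtain ⟨u⟩ : Nonempty (Parametrization E × kˣ ≃ RationalPoint E × (GL (Fin 2) k × kˣ)) :=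
    ⟨(Equiv.prodCongrLeft fun _ => (Equiv.sigmaFiberEquiv Parametrization.point).symm).trans
      ((Equiv.sigmaProdDistrib _ _).trans ((Equiv.sigmaCongrRight fun P =>
        (nonempty_equiv_fiber h2 P).some.symm).trans (Equiv.sigmaEquivProd _ _)))⟩
  obtain ⟨v⟩ := nonempty_parametrization_equiv E
  obtain ⟨w⟩ := nonempty_curveAut_equiv h2 E
  have h3 := Nat.card_congr u
  rw [Nat.card_prod, Nat.card_prod, Nat.card_prod, Nat.card_congr v, Nat.card_prod,
    Nat.card_congr w, Nat.card_prod] at h3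
  have h4 : 0 < Nat.card (RationalPoint E) * Nat.card kˣ := mul_pos Nat.card_pos Nat.card_pos
  refine Nat.eq_of_mul_eq_mul_left h4 ?_
  linarith

end WeierstrassChart

theorem card_GL_eq {k : Type*} [Field k] [Fintype k] : Nat.card (GL (Fin 2) k) =
    (Fintype.card k ^ 2 - 1) * (Fintype.card k ^ 2 - Fintype.card k) := by
  rw [Matrix.card_GL_field]
  simp [Fin.prod_univ_two]

theorem card_PGL2_mul {k : Type*} [Field k] [Fintype k] :
    Nat.card (PGL2 k) * (Fintype.card k - 1) = Nat.card (GL (Fin 2) k) := by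
  rw [Subgroup.card_eq_card_quotient_mul_card_subgroup (Subgroup.center (GL (Fin 2) k))]
  congr 1
  rw [Matrix.GeneralLinearGroup.center_eq_range_scalar]
  have hinj : Function.Injective (Matrix.GeneralLinearGroup.scalar (Fin 2) : kˣ →* GL (Fin 2) k) :=
    fun a b h => Units.ext (by
      have := congrArg (fun g : GL (Fin 2) k => g.1 0 0) h
      simpa using this)
  rw [← Nat.card_congr (MonoidHom.ofInjective hinj).toEquiv, Nat.card_units, Nat.card_eq_fintype_card]

theorem proposition2p2 {F : Type*} [Field F] [Fintype F] (hF : ringChar F ≠ 2)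
    (E : WeierstrassCurve F) [E.IsElliptic] :
    Finite (EllipticAut E) ∧
    (quarticsIsomorphicTo E).Finite ∧
    ((quarticsIsomorphicTo E).ncard : ℚ) =
      ((Fintype.card F : ℚ) - 1) * Nat.card (PGL2 F) / Nat.card (EllipticAut E) ∧
    ((Fintype.card F : ℚ) - 1) * Nat.card (PGL2 F) / Nat.card (EllipticAut E) =
      ((Fintype.card F : ℚ) - 1) ^ 2 * Fintype.card F * ((Fintype.card F : ℚ) + 1) /
        Nat.card (EllipticAut E) := by
  have hmul := WeierstrassChart.card_quartics_mul_card_aut (Ring.two_ne_zero hF) E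
  have hpos : Nat.card (GL (Fin 2) F) ≠ 0 := Nat.card_pos.ne'
  rw [← hmul] at hpos
  have hfin := Nat.finite_of_card_ne_zero (left_ne_zero_of_mul hpos)
  have hA : (Nat.card (EllipticAut E) : ℚ) ≠ 0 := Nat.cast_ne_zero.2 (right_ne_zero_of_mul hpos)
  have hq : 1 ≤ Fintype.card F := Fintype.card_pos
  have hPGL : (Nat.card (PGL2 F) : ℚ) * ((Fintype.card F : ℚ) - 1) = Nat.card (GL (Fin 2) F) := by
    rw [← card_PGL2_mul, Nat.cast_mul, Nat.cast_sub hq, Nat.cast_one]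
  have hGL : (Nat.card (GL (Fin 2) F) : ℚ) =
      ((Fintype.card F : ℚ) ^ 2 - 1) * ((Fintype.card F : ℚ) ^ 2 - Fintype.card F) := by
    rw [card_GL_eq, Nat.cast_mul, Nat.cast_sub (Nat.one_le_pow _ _ hq),
      Nat.cast_sub (Nat.le_self_pow two_ne_zero _)]
    push_cast
    ring
  refine ⟨Nat.finite_of_card_ne_zero (right_ne_zero_of_mul hpos), Set.toFinite _, ?_, ?_⟩
  · rw [eq_div_iff hA, mul_comm (_ - _), hPGL, ← hmul, Nat.cast_mul]
    rfl
  · rw [mul_comm (_ - _), hPGL, hGL]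
    ring
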